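/- Let $M$ be a smooth (Hausdorff, finite-dimensional) manifold and $A\to M$ a smooth real vector bundle of finite rank. Let $(A,M,\rho,S)$ be a left symmetric algebroid: $\rho:A\to TM$ is a bundle homomorphism and $S:\Gamma(A)\times\Gamma(A)\to\Gamma(A)$ is an $\mathbb R$-bilinear product with $S_{fX}Y=fS_XY$, $S_X(fY)=fS_XY+\rho(X)(f)Y$ and $S_XS_YZ-S_YS_XZ-S_{[X,Y]_S}Z=0$, where $[X,Y]_S=S_XY-S_YX$. Define $S^*$ on $\Gamma(A^*)$ by $\langle S^*_X\alpha,Y\rangle=\rho(X).\langle\alpha,Y\rangle-\langle\alpha,S_XY\rangle$. Let $r=\mathfrak a+\mathfrak s\in\Gamma(A\otimes A)$, with skew-symmetric part $\mathfrak a$ and symmetric part $\mathfrak s$, let $r_\#:A^*\to A$ be given by $\beta(r_\#(\alpha))=r(\alpha,\beta)$, and put $$\langle T_\alpha\beta,X\rangle=\rho(X).r(\alpha,\beta)-r(S^*_X\alpha,\beta)-r(\alpha,S^*_X\beta)+\langle S^*_{r_\#(\alpha)}\beta,X\rangle,\qquad [\alpha,\beta]_T=T_\alpha\beta-T_\beta\alpha,$$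 $$\langle\beta,T^*_\alpha X\rangle=\rho(r_\#(\alpha)).\langle\beta,X\rangle-\langle T_\alpha\beta,X\rangle,\qquad \Delta(r)(\alpha,\beta)=r_\#([\alpha,\beta]_T)-[r_\#(\alpha),r_\#(\beta)]_S .$$ Suppose that $r$ is a quasi $\mathbb S$-matrix, that is, for all $X\in\Gamma(A)$ and $\alpha,\beta\in\Gamma(A^*)$, $$\rho(\Delta(r)(\alpha,\beta))=0,\qquad \rho(X).\mathfrak a(\alpha,\beta)-\mathfrak a(S^*_X\alpha,\beta)-\mathfrak a(\alpha,S^*_X\beta)=0,$$ $$[X,\Delta(r)(\alpha,\beta)]_S-\Delta(r)(S^*_X\alpha,\beta)-\Delta(r)(\alpha,S^*_X\beta)=0 .$$ On the sections of $\Phi(A)=A\oplus A^*$ consider the two brackets $$[X+\alpha,Y+\beta]^{\triangleright,r}=[X,Y]_S+S^*_X\beta-S^*_Y\alpha+\Delta(r)(\alpha,\beta),$$ $$[X+\alpha,Y+\beta]^{r}=[X,Y]_S+S^*_X\beta+T^*_\alpha Y-S^*_Y\alpha-T^*_\beta X+[\alpha,\beta]_T,$$ and put $\langle X+\alpha,Y+\beta\rangle_0=\langle\alpha,Y\rangle+\langle\beta,X\rangle$,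 $K_0(X+\alpha)=X-\alpha$, $$\langle X+\alpha,Y+\beta\rangle_r=\langle\alpha,Y\rangle+\langle\beta,X\rangle-2\mathfrak s(\alpha,\beta),\qquad K_r(X+\alpha)=X-\alpha-2r_\#(\alpha).$$ A para-Kähler Lie algebroid is a Lie algebroid with a pseudo-Riemannian metric and a skew-symmetric bundle endomorphism $K$ such that $K^2=\mathrm{id}$ and $\nabla K=0$, where $\nabla$ is the Levi-Civita connection of the metric (the unique linear connection of the Lie algebroid which is metric and torsion free). Then: 1. $(\Phi(A),[\,,]^{\triangleright,r},\rho+0)$ is a Lie algebroid. 2. $(\Phi(A),[\,,]^{r},\rho+\rho\circ r_\#,\langle\,,\rangle_0,K_0)$ (the exact para-Kähler Lie algebroid of $r$) is a para-Kähler Lie algebroid, and $\xi:X+\alpha\mapsto X-r_\#(\alpha)+\alpha$ is an isomorphism of Lie algebroids from $(\Phi(A),[\,,]^{\triangleright,r},\rho+0)$ onto $(\Phi(A),[\,,]^{r},\rho+\rho\circ r_\#)$. It satisfies $\langle\xi(u),\xi(v)\rangle_0=\langle u,v\rangle_r$ and $K_0\circ\xi=\xi\circ K_r$. 3. $(\Phi(A),[\,,]^{\triangleright,r},\rho+0,\langle\,,\rangle_r,K_r)$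 is a para-Kähler Lie algebroid. -/

import Mathlib

open Bundle Module
open scoped Manifold ContDiff Topology TensorProduct

set_option linter.unusedSectionVars false

noncomputable section

namespace ParaKahler

/-! ### Sections, bundle homomorphisms, Lie algebroids

`M` is a smooth manifold modelled on the finite-dimensional space `E`, and `W` is a smooth real
vector bundle over `M` with typical fibre `G`. -/

section General

variable {E : Type*} [NormedAddCommGroup E] [NormedSpace ℝ E]
  {M : Type*} [TopologicalSpace M] [ChartedSpace E M] [IsManifold 𝓘(ℝ, E) ∞ M]
  {G : Type*} [NormedAddCommGroup G] [NormedSpace ℝ G]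
  {W : M → Type*} [TopologicalSpace (TotalSpace G W)]
  [∀ x, AddCommGroup (W x)] [∀ x, Module ℝ (W x)] [∀ x, TopologicalSpace (W x)]
  [FiberBundle G W] [VectorBundle ℝ G W]
  {G' : Type*} [NormedAddCommGroup G'] [NormedSpace ℝ G']
  {W' : M → Type*} [TopologicalSpace (TotalSpace G' W')]
  [∀ x, AddCommGroup (W' x)] [∀ x, Module ℝ (W' x)] [∀ x, TopologicalSpace (W' x)]
  [FiberBundle G' W'] [VectorBundle ℝ G' W']

variable (E G W) in
/-- `Γ(W)`: the global smooth sections of the vector bundle `W`. -/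
abbrev Sec := Cₛ^∞⟮𝓘(ℝ, E); G, W⟯

/-- The product `f s` of a smooth function and a smooth section. -/
def fsmul (f : C^∞⟮𝓘(ℝ, E), M; ℝ⟯) (s : Sec E G W) : Sec E G W :=
  ⟨(f : M → ℝ) • (fun x => s x), f.contMDiff.smul_section s.contMDiff⟩

variable (E G G') in
/-- A fibrewise linear map over the identity of `M` is a (smooth) homomorphism of vector bundles:
the induced map between total spaces is smooth. -/
def IsBundleHom (φ : ∀ x, W x →ₗ[ℝ] W' x) : Prop :=
  ContMDiff (𝓘(ℝ, E).prod 𝓘(ℝ, G)) (𝓘(ℝ, E).prod 𝓘(ℝ, G')) ∞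
    (fun p : TotalSpace G W => (⟨p.1, φ p.1 p.2⟩ : TotalSpace G' W'))

/-- The action of a bundle homomorphism on sections. -/
def mapSec (φ : ∀ x, W x →ₗ[ℝ] W' x) (hφ : IsBundleHom E G G' φ) (s : Sec E G W) :
    Sec E G' W' :=
  ⟨fun x => φ x (s x), ContMDiff.comp hφ s.contMDiff⟩

/-- The function `ρ(a).f`, for a fibrewise linear map `ρ : W → TM`, a section `a` of `W` and a
function `f` on `M`. -/
def anchorDeriv (ρ : ∀ x, W x →ₗ[ℝ] TangentSpace 𝓘(ℝ, E) x) (a : Sec E G W) (f : M → ℝ) : M → ℝ :=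
  fun x => mvfderiv 𝓘(ℝ, E) f x (ρ x (a x))

/-- `(W, M, ρ)` with the bracket `br` on `Γ(W)` is a Lie algebroid: `ρ : W → TM` is a bundle
homomorphism and `br` is a skew-symmetric `ℝ`-bilinear anchored bracket satisfying the Jacobi
identity. -/
structure IsLieAlgebroid (ρ : ∀ x, W x →ₗ[ℝ] TangentSpace 𝓘(ℝ, E) x)
    (br : Sec E G W → Sec E G W → Sec E G W) : Prop where
  anchor_smooth : IsBundleHom E G E ρ
  add_left : ∀ a b c, br (a + b) c = br a c + br b c
  smul_left : ∀ (t : ℝ) a b, br (t • a) b = t • br a b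
  add_right : ∀ a b c, br a (b + c) = br a b + br a c
  smul_right : ∀ (t : ℝ) a b, br a (t • b) = t • br a b
  skew : ∀ a b, br a b = -br b a
  anchored : ∀ a (f : C^∞⟮𝓘(ℝ, E), M; ℝ⟯) b x,
    br a (fsmul f b) x = f x • br a b x + anchorDeriv ρ a f x • b x
  jacobi : ∀ a b c, br (br a b) c + br (br b c) a + br (br c a) b = 0

/-- An isomorphism (over the identity of `M`) between the Lie algebroids `(W, ρ, br)` and
`(W', ρ', br')`: a bundle isomorphism compatible with the anchors and the brackets. -/
structure IsLieAlgebroidIso (ρ : ∀ x, W x →ₗ[ℝ] TangentSpace 𝓘(ℝ, E) x)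
    (br : Sec E G W → Sec E G W → Sec E G W)
    (ρ' : ∀ x, W' x →ₗ[ℝ] TangentSpace 𝓘(ℝ, E) x)
    (br' : Sec E G' W' → Sec E G' W' → Sec E G' W')
    (φ : ∀ x, W x →ₗ[ℝ] W' x) : Prop where
  smooth : IsBundleHom E G G' φ
  exists_inverse : ∃ ψ : ∀ x, W' x →ₗ[ℝ] W x, IsBundleHom E G' G ψ ∧
    (∀ x v, ψ x (φ x v) = v) ∧ ∀ x w, φ x (ψ x w) = w
  map_anchor : ∀ x v, ρ' x (φ x v) = ρ x v
  map_bracket : ∀ a b, mapSec φ smooth (br a b) = br' (mapSec φ smooth a) (mapSec φ smooth b)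

/-- `D` is a right-anchored product on `(W, M, ρ)`, i.e. it satisfies the algebraic rules of a
linear connection: `D (f a) b = f D a b` and `D a (f b) = f D a b + ρ(a)(f) b`. -/
structure IsRightAnchored (ρ : ∀ x, W x →ₗ[ℝ] TangentSpace 𝓘(ℝ, E) x)
    (D : Sec E G W → Sec E G W → Sec E G W) : Prop where
  add_left : ∀ a b c, D (a + b) c = D a c + D b c
  add_right : ∀ a b c, D a (b + c) = D a b + D a c
  smul_right : ∀ (t : ℝ) a b, D a (t • b) = t • D a b
  fsmul_left : ∀ (f : C^∞⟮𝓘(ℝ, E), M; ℝ⟯) a b, D (fsmul f a) b = fsmul f (D a b)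
  anchored : ∀ a (f : C^∞⟮𝓘(ℝ, E), M; ℝ⟯) b x,
    D a (fsmul f b) x = f x • D a b x + anchorDeriv ρ a f x • b x

/-- The bilinear form `g` is symmetric, nondegenerate and of signature `(p, q)`: it is diagonal with `p` entries `1` and `q` entries `-1` in some
basis. -/
def HasSignature {U : Type*} [AddCommGroup U] [Module ℝ U] (g : U →ₗ[ℝ] U →ₗ[ℝ] ℝ)
    (p q : ℕ) : Prop :=
  ∃ b : Basis (Fin p ⊕ Fin q) ℝ U, ∀ i j,
    g (b i) (b j) = if i = j then Sum.elim (fun _ => 1) (fun _ => -1) i else 0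

variable (E G) in
/-- A pseudo-Riemannian metric on the vector bundle `W`. -/
structure IsPseudoRiemannianMetric (g : ∀ x, W x →ₗ[ℝ] W x →ₗ[ℝ] ℝ) : Prop where
  symm : ∀ x u v, g x u v = g x v u
  signature : ∃ p q : ℕ, ∀ x, HasSignature (g x) p q
  smooth : ∀ (U : Set M) (a b : ∀ x, W x), IsOpen U →
    ContMDiffOn 𝓘(ℝ, E) (𝓘(ℝ, E).prod 𝓘(ℝ, G)) ∞ (fun x => TotalSpace.mk' G x (a x)) U →
    ContMDiffOn 𝓘(ℝ, E) (𝓘(ℝ, E).prod 𝓘(ℝ, G)) ∞ (fun x => TotalSpace.mk' G x (b x)) U →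
    ContMDiffOn 𝓘(ℝ, E) 𝓘(ℝ, ℝ) ∞ (fun x => g x (a x) (b x)) U

/-- `D` is the Levi-Civita connection of the pseudo-Riemannian Lie algebroid `(W, ρ, br, g)`: the
unique linear connection which is metric and torsion free. -/
structure IsLeviCivita (ρ : ∀ x, W x →ₗ[ℝ] TangentSpace 𝓘(ℝ, E) x)
    (br : Sec E G W → Sec E G W → Sec E G W) (g : ∀ x, W x →ₗ[ℝ] W x →ₗ[ℝ] ℝ)
    (D : Sec E G W → Sec E G W → Sec E G W) : Prop where
  connection : IsRightAnchored ρ D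
  metric : ∀ a b c x, anchorDeriv ρ a (fun y => g y (b y) (c y)) x =
    g x (D a b x) (c x) + g x (b x) (D a c x)
  torsion_free : ∀ a b, D a b - D b a = br a b

/-- `(W, M, ρ, br, g, K)` is a para-Kähler Lie algebroid: a pseudo-Riemannian Lie algebroid with a
bundle endomorphism `K` such that `K² = id`, `K` is skew-symmetric, and `K` is parallel for the
Levi-Civita connection. -/
structure IsParaKahler (ρ : ∀ x, W x →ₗ[ℝ] TangentSpace 𝓘(ℝ, E) x)
    (br : Sec E G W → Sec E G W → Sec E G W) (g : ∀ x, W x →ₗ[ℝ] W x →ₗ[ℝ] ℝ)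
    (K : ∀ x, W x →ₗ[ℝ] W x) : Prop where
  lieAlgebroid : IsLieAlgebroid ρ br
  metric : IsPseudoRiemannianMetric E G g
  smooth : IsBundleHom E G G K
  involutive : ∀ x v, K x (K x v) = v
  skew : ∀ x u v, g x (K x u) v = -g x u (K x v)
  parallel : ∃ D, IsLeviCivita ρ br g D ∧
    ∀ a b, D a (mapSec K smooth b) = mapSec K smooth (D a b)

end General

/-! ### Left symmetric algebroids

`V` is a smooth real vector bundle of finite rank over `M`, with typical fibre `F`. The fibre at `x`
of the dual bundle is `V x →L[ℝ] ℝ`, and the fibre at `x` of the phase space bundle `V ⊕ V*` is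
`V x × (V x →L[ℝ] ℝ)`. -/

section LeftSymmetric

variable {E : Type*} [NormedAddCommGroup E] [NormedSpace ℝ E] [FiniteDimensional ℝ E]
  {M : Type*} [TopologicalSpace M] [ChartedSpace E M] [IsManifold 𝓘(ℝ, E) ∞ M] [T2Space M]
  {F : Type*} [NormedAddCommGroup F] [NormedSpace ℝ F] [FiniteDimensional ℝ F]
  {V : M → Type*} [TopologicalSpace (TotalSpace F V)]
  [∀ x, AddCommGroup (V x)] [∀ x, Module ℝ (V x)] [∀ x, TopologicalSpace (V x)]
  [FiberBundle F V] [VectorBundle ℝ F V] [ContMDiffVectorBundle ∞ F V 𝓘(ℝ, E)]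

variable (E F V) in
/-- `Γ(V*)`. -/
abbrev CoSec := Sec E (F →L[ℝ] ℝ) (fun x : M => V x →L[ℝ] ℝ)

variable (E F V) in
/-- `Γ(V ⊕ V*)`. -/
abbrev PhaseSec := Sec E (F × (F →L[ℝ] ℝ)) (fun x : M => V x × (V x →L[ℝ] ℝ))

theorem contMDiffAt_coord (e : Trivialization F (TotalSpace.proj : TotalSpace F V → M))
    [MemTrivializationAtlas e] (l : F →L[ℝ] ℝ) {y : M} (hy : y ∈ e.baseSet) :
    ContMDiffAt 𝓘(ℝ, E) (𝓘(ℝ, E).prod 𝓘(ℝ, F →L[ℝ] ℝ)) ∞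
      (fun x => TotalSpace.mk' (F →L[ℝ] ℝ) (E := fun x : M => V x →L[ℝ] ℝ) x
        (l ∘L e.continuousLinearMapAt ℝ x)) y := by
  rw [contMDiffAt_hom_bundle]
  refine ⟨contMDiffAt_id, ?_⟩
  have hy' := FiberBundle.mem_baseSet_trivializationAt F V y
  have := contMDiffAt_coordChangeL (IB := 𝓘(ℝ, E)) (n := ∞) hy' hy
  have h2 : ContMDiffAt 𝓘(ℝ, E) 𝓘(ℝ, F →L[ℝ] ℝ) ∞ (fun x => l ∘L ((trivializationAt F V y).coordChangeL ℝ e x : F →L[ℝ] F)) y :=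
    ContMDiffAt.clm_comp contMDiffAt_const this
  refine h2.congr_of_eventuallyEq ?_
  filter_upwards [e.open_baseSet.mem_nhds hy,
    (trivializationAt F V y).open_baseSet.mem_nhds hy'] with b hb hb'
  ext v
  simp [ContinuousLinearMap.inCoordinates, Trivialization.coordChangeL_apply' _ e ⟨hb', hb⟩,
    Trivialization.coe_linearMapAt_of_mem _ hb, Trivialization.symmL_apply _ hb', Trivialization.mk_symm _ hb']


/-- A smooth frame and coframe near a point, cut off to global sections. -/
theorem exists_frame (x : M) : ∃ (n : ℕ) (s : Fin n → Sec E F V) (c : Fin n → CoSec E F V)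
    (χ : C^∞⟮𝓘(ℝ, E), M; ℝ⟯), (∀ᶠ y in 𝓝 x, χ y = 1) ∧
      ∀ y (v : V y), ∑ i, c i y v • s i y = χ y • v := by
  set e := trivializationAt F V x
  have hx : x ∈ e.baseSet := FiberBundle.mem_baseSet_trivializationAt F V x
  let b := finBasis ℝ F
  obtain ⟨ψ, -, hψ⟩ := (SmoothBumpFunction.nhds_basis_tsupport (I := 𝓘(ℝ, E)) x).mem_iff.1
    (e.open_baseSet.mem_nhds hx)
  refine ⟨_, fun i => ⟨(ψ : M → ℝ) • (e.localFrame b i), ?_⟩,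
    fun i => ⟨(ψ : M → ℝ) • fun y =>
      ((LinearMap.toContinuousLinearMap (b.coord i)) ∘L e.continuousLinearMapAt ℝ y), ?_⟩,
    ⟨fun y => ψ y * ψ y, ψ.contMDiff.mul ψ.contMDiff⟩, ?_, ?_⟩
  · exact ContMDiffOn.smul_section_of_tsupport ψ.contMDiff.contMDiffOn e.open_baseSet hψ
      (e.contMDiffOn_localFrame_baseSet _ b i)
  · exact ContMDiffOn.smul_section_of_tsupport ψ.contMDiff.contMDiffOn e.open_baseSet hψ
      (fun y hy => (contMDiffAt_coord e _ hy).contMDiffWithinAt)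
  · filter_upwards [ψ.eventuallyEq_one] with y hy
    simp [hy]
  · intro y v
    by_cases hy : y ∈ e.baseSet
    · have h := (e.basisAt b hy).sum_repr v
      have h2 : ψ y • ψ y • ∑ i, (e.basisAt b hy).repr v i • e.basisAt b hy i
          = (ψ y * ψ y) • v := by rw [h, smul_smul]
      refine Eq.trans ?_ h2
      rw [Finset.smul_sum, Finset.smul_sum]
      refine Finset.sum_congr rfl fun i _ => ?_
      simp [hy, Trivialization.basisAt, Trivialization.coe_linearMapAt_of_mem, smul_smul]
      ring_nf
    · have : ψ y = 0 := image_eq_zero_of_notMem_tsupport (fun h => hy (hψ h))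
      simp [this]

theorem contMDiff_pair (α : CoSec E F V) (X : Sec E F V) :
    ContMDiff 𝓘(ℝ, E) 𝓘(ℝ, ℝ) ∞ (fun x => α x (X x)) := by
  intro x
  have h := (α.contMDiff x).clm_bundle_apply (E₂ := Bundle.Trivial M ℝ) (X.contMDiff x)
  exact (contMDiffAt_totalSpace.1 h).2

/-- The smooth function `⟨α, X⟩`. -/
def pairFun (α : CoSec E F V) (X : Sec E F V) : C^∞⟮𝓘(ℝ, E), M; ℝ⟯ :=
  ⟨fun x => α x (X x), contMDiff_pair α X⟩

/-- Every element of a fibre is the value of a global section. -/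
theorem exists_sec_eq (x : M) (v : V x) : ∃ X : Sec E F V, X x = v := by
  obtain ⟨n, s, c, χ, hχ, h⟩ := exists_frame (E := E) (F := F) (V := V) x
  refine ⟨∑ i, c i x v • s i, ?_⟩
  have : (⇑(∑ i, c i x v • s i) : ∀ x, V x) = ∑ i, c i x v • ⇑(s i) :=
    map_sum (ContMDiffSection.coeAddHom 𝓘(ℝ, E) F ∞ V) _ _
  rw [this, Finset.sum_apply]
  simpa [hχ.self_of_nhds] using h x v

theorem coe_sum_sec {n : ℕ} {F : Type*} [NormedAddCommGroup F] [NormedSpace ℝ F]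
    {V : M → Type*} [TopologicalSpace (TotalSpace F V)]
    [∀ x, AddCommGroup (V x)] [∀ x, Module ℝ (V x)] [∀ x, TopologicalSpace (V x)]
    [FiberBundle F V] [VectorBundle ℝ F V] (s : Fin n → Sec E F V) (x : M) :
    (∑ i, s i) x = ∑ i, s i x := by
  have : (⇑(∑ i, s i) : ∀ x, V x) = ∑ i, ⇑(s i) :=
    map_sum (ContMDiffSection.coeAddHom 𝓘(ℝ, E) F ∞ V) _ _
  rw [this, Finset.sum_apply]

theorem sum_of_add {G : Type*} [AddCommGroup G] (Φ : G → M → ℝ)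
    (hadd : ∀ a b x, Φ (a + b) x = Φ a x + Φ b x) {n : ℕ} (s : Fin n → G) (x : M) :
    Φ (∑ i, s i) x = ∑ i, Φ (s i) x :=
  map_sum (AddMonoidHom.mk' (fun a => Φ a x) (fun a b => hadd a b x)) s _

/-- A `C^∞(M)`-linear map `Γ(V) → C^∞(M)` is the pairing with a section of `V*`. -/
theorem exists_coSec (Φ : Sec E F V → M → ℝ)
    (hsm : ∀ X, ContMDiff 𝓘(ℝ, E) 𝓘(ℝ, ℝ) ∞ (Φ X))
    (hadd : ∀ X Y x, Φ (X + Y) x = Φ X x + Φ Y x)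
    (hsmul : ∀ f X x, Φ (fsmul f X) x = f x * Φ X x) :
    ∃ α : CoSec E F V, ∀ X x, α x (X x) = Φ X x := by
  choose n s c χ hχ h using exists_frame (E := E) (F := F) (V := V)
  let α : ∀ x, V x →L[ℝ] ℝ := fun x => ∑ i, Φ (s x i) x • c x i x
  have hα : ∀ (X : Sec E F V) x, α x (X x) = Φ X x := by
    intro X x
    have h1 : ∑ i, fsmul (pairFun (c x i) X) (s x i) = fsmul (χ x) X := by
      ext y
      rw [coe_sum_sec]
      exact h x y (X y)
    have h2 := congrArg (fun Z => Φ Z x) h1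
    simp only [sum_of_add Φ hadd, hsmul, (hχ x).self_of_nhds, one_mul] at h2
    rw [← h2]
    simp only [α, sum_apply, smul_apply, smul_eq_mul]
    exact Finset.sum_congr rfl fun i _ => mul_comm _ _
  refine ⟨⟨α, fun x => ?_⟩, hα⟩
  have h3 : ContMDiffAt 𝓘(ℝ, E) (𝓘(ℝ, E).prod 𝓘(ℝ, F →L[ℝ] ℝ)) ∞
      (fun y => TotalSpace.mk' (F →L[ℝ] ℝ) (E := fun x : M => V x →L[ℝ] ℝ) y
        (∑ i, Φ (s x i) y • c x i y)) x :=
    ContMDiffAt.sum_section fun i _ => (hsm (s x i) x).smul_section ((c x i).contMDiff x)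
  refine h3.congr_of_eventuallyEq ?_
  filter_upwards [hχ x] with y hy
  congr 1
  ext v
  have h4 := h x y v
  rw [hy, one_smul] at h4
  conv_lhs => rw [← h4]
  simp only [map_sum, map_smul, hα, sum_apply, smul_apply,
    smul_eq_mul]
  exact Finset.sum_congr rfl fun i _ => mul_comm _ _

/-- A `C^∞(M)`-linear map `Γ(V*) → C^∞(M)` is the pairing with a section of `V`. -/
theorem exists_sec (Ψ : CoSec E F V → M → ℝ)
    (hsm : ∀ α, ContMDiff 𝓘(ℝ, E) 𝓘(ℝ, ℝ) ∞ (Ψ α))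
    (hadd : ∀ α β x, Ψ (α + β) x = Ψ α x + Ψ β x)
    (hsmul : ∀ f α x, Ψ (fsmul f α) x = f x * Ψ α x) :
    ∃ X : Sec E F V, ∀ (α : CoSec E F V) x, α x (X x) = Ψ α x := by
  choose n s c χ hχ h using exists_frame (E := E) (F := F) (V := V)
  let X : ∀ x, V x := fun x => ∑ i, Ψ (c x i) x • s x i x
  have hX : ∀ (α : CoSec E F V) x, α x (X x) = Ψ α x := by
    intro α x
    have h1 : ∑ i, fsmul (pairFun α (s x i)) (c x i) = fsmul (χ x) α := by
      ext y v
      rw [coe_sum_sec]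
      have := congrArg (α y) (h x y v)
      simp only [map_sum, map_smul, smul_eq_mul] at this
      simp only [sum_apply]
      refine Eq.trans ?_ this
      exact Finset.sum_congr rfl fun i _ => mul_comm _ _
    have h2 := congrArg (fun Z => Ψ Z x) h1
    simp only [sum_of_add Ψ hadd, hsmul, (hχ x).self_of_nhds, one_mul] at h2
    rw [← h2]
    simp only [X, map_sum, map_smul, smul_eq_mul]
    exact Finset.sum_congr rfl fun i _ => mul_comm _ _
  refine ⟨⟨X, fun x => ?_⟩, hX⟩
  have h3 : ContMDiffAt 𝓘(ℝ, E) (𝓘(ℝ, E).prod 𝓘(ℝ, F)) ∞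
      (fun y => TotalSpace.mk' F y (∑ i, Ψ (c x i) y • s x i y)) x :=
    ContMDiffAt.sum_section fun i _ => (hsm (c x i) x).smul_section ((s x i).contMDiff x)
  refine h3.congr_of_eventuallyEq ?_
  filter_upwards [hχ x] with y hy
  congr 1
  have h4 := h x y (X y)
  rw [hy, one_smul] at h4
  rw [← h4]
  simp only [hX]


/-- The section of `V*` determined by a `C^∞(M)`-linear map `Γ(V) → C^∞(M)`. -/
def coSecOf (Φ : Sec E F V → M → ℝ)
    (hsm : ∀ X, ContMDiff 𝓘(ℝ, E) 𝓘(ℝ, ℝ) ∞ (Φ X))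
    (hadd : ∀ X Y x, Φ (X + Y) x = Φ X x + Φ Y x)
    (hsmul : ∀ f X x, Φ (fsmul f X) x = f x * Φ X x) : CoSec E F V :=
  (exists_coSec Φ hsm hadd hsmul).choose

theorem coSecOf_apply (Φ : Sec E F V → M → ℝ) (hsm hadd hsmul) (X : Sec E F V) (x : M) :
    coSecOf Φ hsm hadd hsmul x (X x) = Φ X x :=
  (exists_coSec Φ hsm hadd hsmul).choose_spec X x

/-- The section of `V` determined by a `C^∞(M)`-linear map `Γ(V*) → C^∞(M)`. -/
def secOf (Ψ : CoSec E F V → M → ℝ)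
    (hsm : ∀ α, ContMDiff 𝓘(ℝ, E) 𝓘(ℝ, ℝ) ∞ (Ψ α))
    (hadd : ∀ α β x, Ψ (α + β) x = Ψ α x + Ψ β x)
    (hsmul : ∀ f α x, Ψ (fsmul f α) x = f x * Ψ α x) : Sec E F V :=
  (exists_sec Ψ hsm hadd hsmul).choose

theorem secOf_apply (Ψ : CoSec E F V → M → ℝ) (hsm hadd hsmul) (α : CoSec E F V) (x : M) :
    α x (secOf Ψ hsm hadd hsmul x) = Ψ α x :=
  (exists_sec Ψ hsm hadd hsmul).choose_spec α x

variable (E F V) in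
/-- A left symmetric algebroid structure on the vector bundle `V`: an anchor `ρ : V → TM` and a
right-anchored product `S` on `Γ(V)` whose curvature vanishes. -/
structure LeftSymmetricAlgebroid where
  /-- the anchor `ρ` -/
  anchor : ∀ x, V x →ₗ[ℝ] TangentSpace 𝓘(ℝ, E) x
  anchor_smooth : IsBundleHom E F E anchor
  /-- the product `S_X Y` -/
  prod : Sec E F V → Sec E F V → Sec E F V
  rightAnchored : IsRightAnchored anchor prod
  curvature_eq_zero : ∀ X Y Z,
    prod X (prod Y Z) - prod Y (prod X Z) - prod (prod X Y - prod Y X) Z = 0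

/-- The value `t(α, β)` of `t ∈ U ⊗ U` on two covectors: `(u ⊗ v)(α, β) = α(u) β(v)`. -/
def evalTensor {U : Type*} [AddCommGroup U] [Module ℝ U] [TopologicalSpace U]
    (t : U ⊗[ℝ] U) (α β : U →L[ℝ] ℝ) : ℝ :=
  LinearMap.mul' ℝ ℝ (TensorProduct.map (α : U →ₗ[ℝ] ℝ) (β : U →ₗ[ℝ] ℝ) t)

/-- The skew-symmetric part of `t ∈ U ⊗ U`. -/
def skewPart {U : Type*} [AddCommGroup U] [Module ℝ U] (t : U ⊗[ℝ] U) : U ⊗[ℝ] U :=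
  (1 / 2 : ℝ) • (t - TensorProduct.comm ℝ U U t)

/-- The symmetric part of `t ∈ U ⊗ U`. -/
def symmPart {U : Type*} [AddCommGroup U] [Module ℝ U] (t : U ⊗[ℝ] U) : U ⊗[ℝ] U :=
  (1 / 2 : ℝ) • (t + TensorProduct.comm ℝ U U t)

variable (E F V) in
/-- `Γ(V ⊗ V)`: families of tensors `r x ∈ V x ⊗ V x` whose components `r(α, β)` along smooth
sections of `V*` are smooth. -/
structure TensorSec where
  /-- the value of the section at a point -/
  toFun : ∀ x, V x ⊗[ℝ] V x
  smooth : ∀ α β : CoSec E F V,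
    ContMDiff 𝓘(ℝ, E) 𝓘(ℝ, ℝ) ∞ (fun x => evalTensor (toFun x) (α x) (β x))

namespace TensorSec

/-- The bundle map `r_# : V* → V`, `(u ⊗ v)_#(α) = α(u) v`. -/
def sharp (r : TensorSec E F V) (x : M) : (V x →L[ℝ] ℝ) →ₗ[ℝ] V x where
  toFun α := TensorProduct.lid ℝ (V x) (LinearMap.rTensor (V x) (α : V x →ₗ[ℝ] ℝ) (r.toFun x))
  map_add' α β := by simp [LinearMap.rTensor_add]
  map_smul' t α := by simp [LinearMap.rTensor_smul]

/-- `β(r_#(α)) = r(α, β)`. -/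
theorem apply_sharp (r : TensorSec E F V) (x : M) (α β : V x →L[ℝ] ℝ) :
    β (r.sharp x α) = evalTensor (r.toFun x) α β := by
  simp only [sharp, evalTensor, LinearMap.coe_mk, AddHom.coe_mk]
  induction r.toFun x using TensorProduct.induction_on with
  | zero => simp
  | tmul u v => simp
  | add s t hs ht => simp only [map_add, hs, ht]

/-- `r_#(α)` as a smooth section of `V`, for a smooth section `α` of `V*`. -/
def sharpSec (r : TensorSec E F V) (α : CoSec E F V) : Sec E F V where
  toFun x := r.sharp x (α x)
  contMDiff_toFun := by
    obtain ⟨X, hX⟩ := exists_sec (fun (β : CoSec E F V) x => β x (r.sharp x (α x)))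
      (fun β => by simpa only [apply_sharp] using r.smooth α β)
      (fun β γ x => rfl) (fun f β x => rfl)
    have h : ∀ x, r.sharp x (α x) = X x := by
      intro x
      obtain ⟨n, s, c, χ, hχ, h⟩ := exists_frame (E := E) (F := F) (V := V) x
      have h1 := h x (X x)
      have h2 := h x (r.sharp x (α x))
      simp only [hX] at h1
      have h3 : χ x = 1 := hχ.self_of_nhds
      rw [h3, one_smul] at h1 h2
      exact h2.symm.trans h1
    simpa only [h] using X.contMDiff

end TensorSec

/-- The section `X + α` of `V ⊕ V*`. -/
def phaseMk (X : Sec E F V) (α : CoSec E F V) : PhaseSec E F V where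
  toFun x := (X x, α x)
  contMDiff_toFun x := by
    have h1 := (contMDiffAt_totalSpace.1 (X.contMDiff x)).2
    have h2 := (contMDiffAt_totalSpace.1 (α.contMDiff x)).2
    exact contMDiffAt_totalSpace.2 ⟨contMDiffAt_id, h1.prodMk_space h2⟩

/-- The component in `Γ(V)` of a section of `V ⊕ V*`. -/
def phaseFst (a : PhaseSec E F V) : Sec E F V where
  toFun x := (a x).1
  contMDiff_toFun x := by
    have h := (contMDiffAt_totalSpace.1 (a.contMDiff x)).2
    exact contMDiffAt_totalSpace.2 ⟨contMDiffAt_id, (ContinuousLinearMap.fst ℝ F (F →L[ℝ] ℝ)).contMDiff.contMDiffAt.comp x h⟩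

/-- The component in `Γ(V*)` of a section of `V ⊕ V*`. -/
def phaseSnd (a : PhaseSec E F V) : CoSec E F V where
  toFun x := (a x).2
  contMDiff_toFun x := by
    have h := (contMDiffAt_totalSpace.1 (a.contMDiff x)).2
    exact contMDiffAt_totalSpace.2 ⟨contMDiffAt_id, (ContinuousLinearMap.snd ℝ F (F →L[ℝ] ℝ)).contMDiff.contMDiffAt.comp x h⟩


theorem contMDiff_anchorDeriv (ρ : ∀ x, V x →ₗ[ℝ] TangentSpace 𝓘(ℝ, E) x)
    (hρ : IsBundleHom E F E ρ) (X : Sec E F V) (f : M → ℝ) (hf : ContMDiff 𝓘(ℝ, E) 𝓘(ℝ, ℝ) ∞ f) :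
    ContMDiff 𝓘(ℝ, E) 𝓘(ℝ, ℝ) ∞ (anchorDeriv ρ X f) :=
  (contMDiff_snd_tangentBundle_modelSpace ℝ 𝓘(ℝ, ℝ)).comp
    ((hf.contMDiff_tangentMap (m := ∞) (by simp)).comp (mapSec ρ hρ X).contMDiff)

theorem anchorDeriv_add (ρ : ∀ x, V x →ₗ[ℝ] TangentSpace 𝓘(ℝ, E) x) (X : Sec E F V) (f g : M → ℝ)
    (hf : ContMDiff 𝓘(ℝ, E) 𝓘(ℝ, ℝ) ∞ f) (hg : ContMDiff 𝓘(ℝ, E) 𝓘(ℝ, ℝ) ∞ g) (x : M) :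
    anchorDeriv ρ X (fun y => f y + g y) x = anchorDeriv ρ X f x + anchorDeriv ρ X g x := by
  have := mvfderiv_add (hf.mdifferentiable (by simp) x) (hg.mdifferentiable (by simp) x)
  exact DFunLike.congr_fun this (ρ x (X x))

theorem anchorDeriv_mul (ρ : ∀ x, V x →ₗ[ℝ] TangentSpace 𝓘(ℝ, E) x) (X : Sec E F V) (f g : M → ℝ)
    (hf : ContMDiff 𝓘(ℝ, E) 𝓘(ℝ, ℝ) ∞ f) (hg : ContMDiff 𝓘(ℝ, E) 𝓘(ℝ, ℝ) ∞ g) (x : M) :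
    anchorDeriv ρ X (fun y => f y * g y) x =
      f x * anchorDeriv ρ X g x + anchorDeriv ρ X f x * g x := by
  have := mvfderiv_mul (hf.mdifferentiable (by simp) x) (hg.mdifferentiable (by simp) x)
  have h := DFunLike.congr_fun this (ρ x (X x))
  refine Eq.trans h ?_
  simp [anchorDeriv, mul_comm]

theorem anchorDeriv_add_left (ρ : ∀ x, V x →ₗ[ℝ] TangentSpace 𝓘(ℝ, E) x) (X Y : Sec E F V)
    (f : M → ℝ) (x : M) :
    anchorDeriv ρ (X + Y) f x = anchorDeriv ρ X f x + anchorDeriv ρ Y f x := by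
  simp [anchorDeriv]

theorem anchorDeriv_fsmul_left (ρ : ∀ x, V x →ₗ[ℝ] TangentSpace 𝓘(ℝ, E) x)
    (h : C^∞⟮𝓘(ℝ, E), M; ℝ⟯) (X : Sec E F V) (f : M → ℝ) (x : M) :
    anchorDeriv ρ (fsmul h X) f x = h x * anchorDeriv ρ X f x := by
  have : fsmul h X x = h x • X x := rfl
  simp [anchorDeriv, this]

namespace LeftSymmetricAlgebroid

/-- The bracket `[X, Y]_S = S_X Y - S_Y X`. -/
def bracket (L : LeftSymmetricAlgebroid E F V) (X Y : Sec E F V) : Sec E F V :=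
  L.prod X Y - L.prod Y X

/-- The dual product `S*_X α`: `⟨S*_X α, Y⟩ = ρ(X).⟨α, Y⟩ - ⟨α, S_X Y⟩`. -/
def dual (L : LeftSymmetricAlgebroid E F V) (X : Sec E F V) (α : CoSec E F V) : CoSec E F V :=
  coSecOf (fun Y x => anchorDeriv L.anchor X (fun y => α y (Y y)) x - α x (L.prod X Y x))
    (fun Y => (contMDiff_anchorDeriv _ L.anchor_smooth X _ (contMDiff_pair α Y)).sub
      (contMDiff_pair α _))
    (fun Y Z x => by
      have h := anchorDeriv_add L.anchor X _ _ (contMDiff_pair α Y) (contMDiff_pair α Z) x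
      have h2 : (fun y => α y ((Y + Z) y)) = fun y => α y (Y y) + α y (Z y) := by
        funext y; simp
      rw [h2, h, L.rightAnchored.add_right]
      simp only [ContMDiffSection.coe_add, Pi.add_apply, map_add]
      ring)
    (fun f Y x => by
      have h := anchorDeriv_mul L.anchor X _ _ f.contMDiff (contMDiff_pair α Y) x
      have h2 : (fun y => α y (fsmul f Y y)) = fun y => f y * α y (Y y) := by
        funext y; exact (α y).map_smul (f y) (Y y)
      rw [h2, h, L.rightAnchored.anchored]
      simp only [map_add, map_smul, smul_eq_mul]
      ring)

theorem dual_apply (L : LeftSymmetricAlgebroid E F V) (X : Sec E F V) (α : CoSec E F V)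
    (Y : Sec E F V) (x : M) : L.dual X α x (Y x) =
      anchorDeriv L.anchor X (fun y => α y (Y y)) x - α x (L.prod X Y x) :=
  coSecOf_apply _ _ _ _ Y x

theorem dual_add_left (L : LeftSymmetricAlgebroid E F V) (X Y : Sec E F V) (α : CoSec E F V)
    (x : M) : L.dual (X + Y) α x = L.dual X α x + L.dual Y α x := by
  ext v
  obtain ⟨Z, rfl⟩ := exists_sec_eq (E := E) (F := F) x v
  simp only [add_apply, dual_apply, anchorDeriv_add_left, L.rightAnchored.add_left,
    ContMDiffSection.coe_add, Pi.add_apply, map_add]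
  ring

theorem dual_fsmul_left (L : LeftSymmetricAlgebroid E F V) (f : C^∞⟮𝓘(ℝ, E), M; ℝ⟯)
    (X : Sec E F V) (α : CoSec E F V) (x : M) : L.dual (fsmul f X) α x = f x • L.dual X α x := by
  ext v
  obtain ⟨Z, rfl⟩ := exists_sec_eq (E := E) (F := F) x v
  have h : fsmul f (L.prod X Z) x = f x • L.prod X Z x := rfl
  simp only [smul_apply, dual_apply, anchorDeriv_fsmul_left, L.rightAnchored.fsmul_left,
    h, map_smul, smul_eq_mul]
  ring

theorem dual_add_right (L : LeftSymmetricAlgebroid E F V) (X : Sec E F V) (α β : CoSec E F V)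
    (x : M) : L.dual X (α + β) x = L.dual X α x + L.dual X β x := by
  ext v
  obtain ⟨Z, rfl⟩ := exists_sec_eq (E := E) (F := F) x v
  have h := anchorDeriv_add L.anchor X _ _ (contMDiff_pair α Z) (contMDiff_pair β Z) x
  simp only [add_apply, dual_apply, ContMDiffSection.coe_add, Pi.add_apply]
  rw [h]
  ring

theorem dual_fsmul_right (L : LeftSymmetricAlgebroid E F V) (f : C^∞⟮𝓘(ℝ, E), M; ℝ⟯)
    (X : Sec E F V) (α : CoSec E F V) (x : M) :
    L.dual X (fsmul f α) x = f x • L.dual X α x + anchorDeriv L.anchor X f x • α x := by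
  ext v
  obtain ⟨Z, rfl⟩ := exists_sec_eq (E := E) (F := F) x v
  have h := anchorDeriv_mul L.anchor X _ _ f.contMDiff (contMDiff_pair α Z) x
  have h2 : ∀ y, fsmul f α y = f y • α y := fun y => rfl
  simp only [add_apply, smul_apply, dual_apply, h2, smul_eq_mul]
  rw [h]
  ring

/-- The product `T` on `Γ(V*)` associated with `r`:
`⟨T_α β, X⟩ = ρ(X).r(α, β) - r(S*_X α, β) - r(α, S*_X β) + ⟨S*_{r_#(α)} β, X⟩`. -/
def dualProd (L : LeftSymmetricAlgebroid E F V) (r : TensorSec E F V) (α β : CoSec E F V) :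
    CoSec E F V :=
  coSecOf (fun X x => anchorDeriv L.anchor X (fun y => evalTensor (r.toFun y) (α y) (β y)) x
      - evalTensor (r.toFun x) (L.dual X α x) (β x) - evalTensor (r.toFun x) (α x) (L.dual X β x)
      + L.dual (r.sharpSec α) β x (X x))
    (fun X => (((contMDiff_anchorDeriv _ L.anchor_smooth X _ (r.smooth α β)).sub
      (r.smooth _ _)).sub (r.smooth _ _)).add (contMDiff_pair _ _))
    (fun X Y x => by
      simp only [← TensorSec.apply_sharp, anchorDeriv_add_left, dual_add_left, map_add,
        add_apply, ContMDiffSection.coe_add, Pi.add_apply]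
      ring)
    (fun f X x => by
      have h : fsmul f X x = f x • X x := rfl
      simp only [← TensorSec.apply_sharp, anchorDeriv_fsmul_left, dual_fsmul_left, map_smul,
        smul_apply, h, smul_eq_mul]
      ring)

theorem dualProd_apply (L : LeftSymmetricAlgebroid E F V) (r : TensorSec E F V)
    (α β : CoSec E F V) (X : Sec E F V) (x : M) : L.dualProd r α β x (X x) =
      anchorDeriv L.anchor X (fun y => evalTensor (r.toFun y) (α y) (β y)) x
      - evalTensor (r.toFun x) (L.dual X α x) (β x) - evalTensor (r.toFun x) (α x) (L.dual X β x)
      + L.dual (r.sharpSec α) β x (X x) :=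
  coSecOf_apply _ _ _ _ X x

theorem dualProd_add_right (L : LeftSymmetricAlgebroid E F V) (r : TensorSec E F V)
    (α β γ : CoSec E F V) (x : M) :
    L.dualProd r α (β + γ) x = L.dualProd r α β x + L.dualProd r α γ x := by
  ext v
  obtain ⟨X, rfl⟩ := exists_sec_eq (E := E) (F := F) x v
  have h := anchorDeriv_add L.anchor X _ _ (r.smooth α β) (r.smooth α γ) x
  simp only [add_apply, dualProd_apply, ← TensorSec.apply_sharp, dual_add_right,
    ContMDiffSection.coe_add, Pi.add_apply] at h ⊢
  rw [h]
  ring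

theorem dualProd_fsmul_right (L : LeftSymmetricAlgebroid E F V) (r : TensorSec E F V)
    (α : CoSec E F V) (f : C^∞⟮𝓘(ℝ, E), M; ℝ⟯) (β : CoSec E F V) (x : M) :
    L.dualProd r α (fsmul f β) x =
      f x • L.dualProd r α β x + anchorDeriv L.anchor (r.sharpSec α) f x • β x := by
  ext v
  obtain ⟨X, rfl⟩ := exists_sec_eq (E := E) (F := F) x v
  have h := anchorDeriv_mul L.anchor X _ _ f.contMDiff (r.smooth α β) x
  have h2 : ∀ y, fsmul f β y = f y • β y := fun y => rfl
  simp only [add_apply, smul_apply, dualProd_apply, ← TensorSec.apply_sharp, dual_fsmul_right,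
    h2, smul_eq_mul] at h ⊢
  rw [h]
  ring

/-- The dual `T*_α Y` of the product `T`, under the identification `V** = V`, where the anchor of
`T` is `ρ_r = ρ ∘ r_#`: `⟨β, T*_α Y⟩ = ρ_r(α).⟨β, Y⟩ - ⟨T_α β, Y⟩`. -/
def dualProdDual (L : LeftSymmetricAlgebroid E F V) (r : TensorSec E F V) (α : CoSec E F V)
    (Y : Sec E F V) : Sec E F V :=
  secOf (fun β x => anchorDeriv L.anchor (r.sharpSec α) (fun y => β y (Y y)) x
      - L.dualProd r α β x (Y x))
    (fun β => (contMDiff_anchorDeriv _ L.anchor_smooth _ _ (contMDiff_pair β Y)).sub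
      (contMDiff_pair _ Y))
    (fun β γ x => by
      have h := anchorDeriv_add L.anchor (r.sharpSec α) _ _ (contMDiff_pair β Y)
        (contMDiff_pair γ Y) x
      simp only [dualProd_add_right, ContMDiffSection.coe_add, Pi.add_apply, add_apply] at h ⊢
      rw [h]
      ring)
    (fun f β x => by
      have h := anchorDeriv_mul L.anchor (r.sharpSec α) _ _ f.contMDiff (contMDiff_pair β Y) x
      have h2 : ∀ y, fsmul f β y = f y • β y := fun y => rfl
      simp only [dualProd_fsmul_right, h2, add_apply, smul_apply, smul_eq_mul] at h ⊢
      rw [h]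
      ring)

theorem apply_dualProdDual (L : LeftSymmetricAlgebroid E F V) (r : TensorSec E F V)
    (α : CoSec E F V) (Y : Sec E F V) (β : CoSec E F V) (x : M) :
    β x (L.dualProdDual r α Y x) =
      anchorDeriv L.anchor (r.sharpSec α) (fun y => β y (Y y)) x - L.dualProd r α β x (Y x) :=
  secOf_apply _ _ _ _ β x

/-- `Δ(r)(α, β) = r_#([α, β]_T) - [r_#(α), r_#(β)]_S`, where `[α, β]_T = T_α β - T_β α`. -/
def delta (L : LeftSymmetricAlgebroid E F V) (r : TensorSec E F V) (α β : CoSec E F V) :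
    Sec E F V :=
  r.sharpSec (L.dualProd r α β - L.dualProd r β α) - L.bracket (r.sharpSec α) (r.sharpSec β)

/-- `r = 𝔞 + 𝔰` (skew-symmetric plus symmetric part) is a quasi `𝕊`-matrix: `ρ ∘ Δ(r) = 0`,
`S 𝔞 = 0`, and `[X, Δ(r)(α, β)] = Δ(r)(S*_X α, β) + Δ(r)(α, S*_X β)`. -/
structure IsQuasiSMatrix (L : LeftSymmetricAlgebroid E F V) (r : TensorSec E F V) : Prop where
  anchor_delta : ∀ α β x, L.anchor x (L.delta r α β x) = 0
  skew_parallel : ∀ (X : Sec E F V) (α β : CoSec E F V) x,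
    anchorDeriv L.anchor X (fun y => evalTensor (skewPart (r.toFun y)) (α y) (β y)) x
      - evalTensor (skewPart (r.toFun x)) (L.dual X α x) (β x)
      - evalTensor (skewPart (r.toFun x)) (α x) (L.dual X β x) = 0
  delta_invariant : ∀ (X : Sec E F V) (α β : CoSec E F V),
    L.bracket X (L.delta r α β) - L.delta r (L.dual X α) β - L.delta r α (L.dual X β) = 0

/-- The anchor `ρ + 0` of `V ⊕ V*`. -/
def anchorZero (L : LeftSymmetricAlgebroid E F V) (x : M) :
    V x × (V x →L[ℝ] ℝ) →ₗ[ℝ] TangentSpace 𝓘(ℝ, E) x :=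
  L.anchor x ∘ₗ LinearMap.fst ℝ _ _

/-- The anchor `ρ + ρ_r` of `V ⊕ V*`, where `ρ_r = ρ ∘ r_#`. -/
def anchorExact (L : LeftSymmetricAlgebroid E F V) (r : TensorSec E F V) (x : M) :
    V x × (V x →L[ℝ] ℝ) →ₗ[ℝ] TangentSpace 𝓘(ℝ, E) x :=
  (L.anchor x).coprod (L.anchor x ∘ₗ r.sharp x)

/-- The bracket `[X + α, Y + β]^▷ = [X, Y]_S + S*_X β - S*_Y α` on `Γ(V ⊕ V*)`. -/
def bracketTri (L : LeftSymmetricAlgebroid E F V) (a b : PhaseSec E F V) : PhaseSec E F V :=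
  phaseMk (L.bracket (phaseFst a) (phaseFst b))
    (L.dual (phaseFst a) (phaseSnd b) - L.dual (phaseFst b) (phaseSnd a))

/-- The bracket `[X + α, Y + β]^{▷,r} = [X + α, Y + β]^▷ + Δ(r)(α, β)` on `Γ(V ⊕ V*)`. -/
def bracketTriR (L : LeftSymmetricAlgebroid E F V) (r : TensorSec E F V) (a b : PhaseSec E F V) :
    PhaseSec E F V :=
  L.bracketTri a b + phaseMk (L.delta r (phaseSnd a) (phaseSnd b)) 0

/-- The bracket of the exact para-Kähler Lie algebroid of `r`:
`[X + α, Y + β]^r = [X, Y]_S + S*_X β + T*_α Y - S*_Y α - T*_β X + [α, β]_T`. -/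
def bracketExact (L : LeftSymmetricAlgebroid E F V) (r : TensorSec E F V) (a b : PhaseSec E F V) :
    PhaseSec E F V :=
  phaseMk
    (L.bracket (phaseFst a) (phaseFst b) + L.dualProdDual r (phaseSnd a) (phaseFst b)
      - L.dualProdDual r (phaseSnd b) (phaseFst a))
    (L.dual (phaseFst a) (phaseSnd b) - L.dual (phaseFst b) (phaseSnd a)
      + (L.dualProd r (phaseSnd a) (phaseSnd b) - L.dualProd r (phaseSnd b) (phaseSnd a)))

end LeftSymmetricAlgebroid

/-! ### Fibrewise linear algebra on `V ⊕ V*` -/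

/-- `⟨u + α, v + β⟩₀ = ⟨α, v⟩ + ⟨β, u⟩`. -/
def phaseMetric {U : Type*} [AddCommGroup U] [Module ℝ U] [TopologicalSpace U] :
    U × (U →L[ℝ] ℝ) →ₗ[ℝ] U × (U →L[ℝ] ℝ) →ₗ[ℝ] ℝ :=
  LinearMap.mk₂ ℝ (fun a b => a.2 b.1 + b.2 a.1)
    (fun a b c => by simp; ring) (fun t a b => by simp; ring)
    (fun a b c => by simp; ring) (fun t a b => by simp; ring)

/-- `K₀(u + α) = u - α`. -/
def phaseK {U : Type*} [AddCommGroup U] [Module ℝ U] [TopologicalSpace U] :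
    U × (U →L[ℝ] ℝ) →ₗ[ℝ] U × (U →L[ℝ] ℝ) where
  toFun a := (a.1, -a.2)
  map_add' a b := by ext <;> simp; ring
  map_smul' t a := by simp

namespace TensorSec

/-- `⟨X + α, Y + β⟩_r = ⟨α, Y⟩ + ⟨β, X⟩ - 2 𝔰(α, β)`, where `𝔰` is the symmetric part of `r`. -/
def phaseMetric (r : TensorSec E F V) (x : M) :
    V x × (V x →L[ℝ] ℝ) →ₗ[ℝ] V x × (V x →L[ℝ] ℝ) →ₗ[ℝ] ℝ :=
  LinearMap.mk₂ ℝ (fun a b => a.2 b.1 + b.2 a.1 - 2 * evalTensor (symmPart (r.toFun x)) a.2 b.2)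
    (fun a b c => by simp [evalTensor, TensorProduct.map_add_left]; ring)
    (fun t a b => by simp [evalTensor, TensorProduct.map_smul_left]; ring)
    (fun a b c => by simp [evalTensor, TensorProduct.map_add_right]; ring)
    (fun t a b => by simp [evalTensor, TensorProduct.map_smul_right]; ring)

/-- `K_r(X + α) = X - α - 2 r_#(α)`. -/
def phaseK (r : TensorSec E F V) (x : M) :
    V x × (V x →L[ℝ] ℝ) →ₗ[ℝ] V x × (V x →L[ℝ] ℝ) where
  toFun a := (a.1 - (2 : ℝ) • r.sharp x a.2, -a.2)
  map_add' a b := by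
    refine Prod.ext ?_ ?_
    · simp; abel
    · simp; abel
  map_smul' t a := by
    refine Prod.ext ?_ ?_
    · simp [smul_sub, smul_comm t (2 : ℝ)]
    · simp

/-- `ξ(X + α) = X - r_#(α) + α`. -/
def xi (r : TensorSec E F V) (x : M) :
    V x × (V x →L[ℝ] ℝ) →ₗ[ℝ] V x × (V x →L[ℝ] ℝ) where
  toFun a := (a.1 - r.sharp x a.2, a.2)
  map_add' a b := by
    refine Prod.ext ?_ ?_
    · simp; abel
    · simp
  map_smul' t a := by
    refine Prod.ext ?_ ?_
    · simp [smul_sub]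
    · simp

end TensorSec

end LeftSymmetric

end ParaKahler

end

/-! Write $\nabla r_\#$ for the derivative $S_X(r_\#\alpha)-r_\#(S^*_X\alpha)$ (`sharpDeriv`), which
is tensorial in $\alpha$. Since $S\mathfrak a=0$, the number
$\langle\beta,(\nabla_Xr_\#)\alpha\rangle$ is symmetric in $\alpha,\beta$. Hence
$[\alpha,\beta]_T=S^*_{r_\#\alpha}\beta-S^*_{r_\#\beta}\alpha$, and
$\Delta(r)(\alpha,\beta)=(\nabla_{r_\#\beta}r_\#)\alpha-(\nabla_{r_\#\alpha}r_\#)\beta$, so the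
cyclic sum of $\langle\gamma,\Delta(r)(\alpha,\beta)\rangle$ vanishes (`delta_cyclic`).
Differentiating this relation along $X$, with $\rho\circ\Delta(r)=0$ and the invariance of
$\Delta(r)$, makes the cyclic sum of $S^*_{\Delta(r)(\alpha,\beta)}\gamma$ vanish
(`dual_delta_cyclic`). Since $[\,,]_S$ is a Lie bracket and $S^*$ a representation of it, this is
what the Jacobi identity of $[\,,]^{\triangleright,r}$ needs (`bracketTriR_jacobi`).

The other axioms are easiest for $[\,,]^r$. For any $r$ it is the commutator of the explicit
connection $D_{X+\alpha}(Y+\beta)=S_XY+T^*_\alpha Y+S^*_X\beta+T_\alpha\beta$, which is metric for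
$\langle\,,\rangle_0$ by duality and preserves $A$ and $A^*$, the eigenbundles of $K_0$. The map
$\xi$ intertwines the two brackets (`isLieAlgebroidIso_xi`). The Jacobi identity is therefore pushed
forward along $\xi$ to $[\,,]^r$, and the whole para-Kähler structure is then pulled back. The
argument is not circular, because `IsLieAlgebroidIso` does not presuppose the Lie algebroid axioms
on either side. -/

noncomputable section

namespace ParaKahler

/-! ### Transport of Lie algebroid and para-Kähler structures along isomorphisms. -/

section Transport

variable {E : Type*} [NormedAddCommGroup E] [NormedSpace ℝ E]
  {M : Type*} [TopologicalSpace M] [ChartedSpace E M] [IsManifold 𝓘(ℝ, E) ∞ M]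
  {G : Type*} [NormedAddCommGroup G] [NormedSpace ℝ G]
  {W : M → Type*} [TopologicalSpace (TotalSpace G W)]
  [∀ x, AddCommGroup (W x)] [∀ x, Module ℝ (W x)] [∀ x, TopologicalSpace (W x)]
  [FiberBundle G W] [VectorBundle ℝ G W]
  {G' : Type*} [NormedAddCommGroup G'] [NormedSpace ℝ G']
  {W' : M → Type*} [TopologicalSpace (TotalSpace G' W')]
  [∀ x, AddCommGroup (W' x)] [∀ x, Module ℝ (W' x)] [∀ x, TopologicalSpace (W' x)]
  [FiberBundle G' W'] [VectorBundle ℝ G' W']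
  {G'' : Type*} [NormedAddCommGroup G''] [NormedSpace ℝ G'']
  {W'' : M → Type*} [TopologicalSpace (TotalSpace G'' W'')]
  [∀ x, AddCommGroup (W'' x)] [∀ x, Module ℝ (W'' x)] [∀ x, TopologicalSpace (W'' x)]
  [FiberBundle G'' W''] [VectorBundle ℝ G'' W'']

theorem fsmul_apply (f : C^∞⟮𝓘(ℝ, E), M; ℝ⟯) (s : Sec E G W) (x : M) :
    fsmul f s x = f x • s x := rfl

theorem mapSec_apply (φ : ∀ x, W x →ₗ[ℝ] W' x) (hφ : IsBundleHom E G G' φ) (s : Sec E G W)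
    (x : M) : mapSec φ hφ s x = φ x (s x) := rfl

theorem mapSec_add (φ : ∀ x, W x →ₗ[ℝ] W' x) (hφ : IsBundleHom E G G' φ) (s t : Sec E G W) :
    mapSec φ hφ (s + t) = mapSec φ hφ s + mapSec φ hφ t := by
  ext x
  exact map_add (φ x) (s x) (t x)

theorem mapSec_sub (φ : ∀ x, W x →ₗ[ℝ] W' x) (hφ : IsBundleHom E G G' φ) (s t : Sec E G W) :
    mapSec φ hφ (s - t) = mapSec φ hφ s - mapSec φ hφ t := by
  ext x
  exact map_sub (φ x) (s x) (t x)

theorem mapSec_neg (φ : ∀ x, W x →ₗ[ℝ] W' x) (hφ : IsBundleHom E G G' φ) (s : Sec E G W) :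
    mapSec φ hφ (-s) = -mapSec φ hφ s := by
  ext x
  exact map_neg (φ x) (s x)

theorem mapSec_zero (φ : ∀ x, W x →ₗ[ℝ] W' x) (hφ : IsBundleHom E G G' φ) :
    mapSec φ hφ (0 : Sec E G W) = 0 := by
  ext x
  exact map_zero (φ x)

theorem mapSec_smul (φ : ∀ x, W x →ₗ[ℝ] W' x) (hφ : IsBundleHom E G G' φ) (c : ℝ)
    (s : Sec E G W) : mapSec φ hφ (c • s) = c • mapSec φ hφ s := by
  ext x
  exact map_smul (φ x) c (s x)

theorem mapSec_fsmul (φ : ∀ x, W x →ₗ[ℝ] W' x) (hφ : IsBundleHom E G G' φ)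
    (f : C^∞⟮𝓘(ℝ, E), M; ℝ⟯) (s : Sec E G W) :
    mapSec φ hφ (fsmul f s) = fsmul f (mapSec φ hφ s) := by
  ext x
  exact map_smul (φ x) (f x) (s x)

theorem mapSec_mapSec_of_leftInverse (φ : ∀ x, W x →ₗ[ℝ] W' x) (hφ : IsBundleHom E G G' φ)
    (ψ : ∀ x, W' x →ₗ[ℝ] W x) (hψ : IsBundleHom E G' G ψ) (h : ∀ x v, ψ x (φ x v) = v)
    (s : Sec E G W) : mapSec ψ hψ (mapSec φ hφ s) = s := by
  ext x
  exact h x (s x)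

theorem IsBundleHom.comp {φ : ∀ x, W x →ₗ[ℝ] W' x} {ψ : ∀ x, W' x →ₗ[ℝ] W'' x}
    (hψ : IsBundleHom E G' G'' ψ) (hφ : IsBundleHom E G G' φ) :
    IsBundleHom E G G'' (fun x => ψ x ∘ₗ φ x) :=
  ContMDiff.comp hψ hφ

/-- The commutator of a linear connection satisfies all the axioms of a Lie algebroid bracket
except for the Jacobi identity. -/
theorem IsRightAnchored.isLieAlgebroid {ρ : ∀ x, W x →ₗ[ℝ] TangentSpace 𝓘(ℝ, E) x}
    {br D : Sec E G W → Sec E G W → Sec E G W} (hD : IsRightAnchored ρ D)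
    (hρ : IsBundleHom E G E ρ) (h : ∀ a b, D a b - D b a = br a b)
    (jacobi : ∀ a b c, br (br a b) c + br (br b c) a + br (br c a) b = 0) :
    IsLieAlgebroid ρ br := by
  -- Real homogeneity in the first slot is the case of a constant function in `fsmul_left`.
  have smul_left : ∀ (t : ℝ) a b, D (t • a) b = t • D a b := fun t a b =>
    hD.fsmul_left ⟨fun _ => t, contMDiff_const⟩ a b
  refine ⟨hρ, ?_, ?_, ?_, ?_, ?_, ?_, jacobi⟩
  · intro a b c
    simp only [← h, hD.add_left, hD.add_right]
    abel
  · intro t a b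
    simp only [← h, smul_left, hD.smul_right, smul_sub]
  · intro a b c
    simp only [← h, hD.add_left, hD.add_right]
    abel
  · intro t a b
    simp only [← h, smul_left, hD.smul_right, smul_sub]
  · intro a b
    simp only [← h]
    abel
  · intro a f b x
    simp only [← h, ContMDiffSection.coe_sub, Pi.sub_apply, hD.anchored, hD.fsmul_left,
      fsmul_apply, smul_sub]
    abel

theorem anchorDeriv_mapSec {ρ : ∀ x, W x →ₗ[ℝ] TangentSpace 𝓘(ℝ, E) x}
    {ρ' : ∀ x, W' x →ₗ[ℝ] TangentSpace 𝓘(ℝ, E) x}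
    (φ : ∀ x, W x →ₗ[ℝ] W' x) (hφ : IsBundleHom E G G' φ)
    (h : ∀ x v, ρ' x (φ x v) = ρ x v) (a : Sec E G W) (f : M → ℝ) :
    anchorDeriv ρ' (mapSec φ hφ a) f = anchorDeriv ρ a f := by
  funext x
  simp only [anchorDeriv, mapSec_apply, h]

/-- Goes from source to target and needs nothing but the Jacobi identity at the source. This is how
$[\,,]^r$ acquires its Jacobi identity before either side is known to be a Lie algebroid. -/
theorem IsLieAlgebroidIso.jacobi {ρ : ∀ x, W x →ₗ[ℝ] TangentSpace 𝓘(ℝ, E) x}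
    {br : Sec E G W → Sec E G W → Sec E G W}
    {ρ' : ∀ x, W' x →ₗ[ℝ] TangentSpace 𝓘(ℝ, E) x}
    {br' : Sec E G' W' → Sec E G' W' → Sec E G' W'} {φ : ∀ x, W x →ₗ[ℝ] W' x}
    (h : IsLieAlgebroidIso ρ br ρ' br' φ)
    (jacobi : ∀ a b c, br (br a b) c + br (br b c) a + br (br c a) b = 0)
    (a b c : Sec E G' W') : br' (br' a b) c + br' (br' b c) a + br' (br' c a) b = 0 := by
  obtain ⟨ψ, hψ, h1, h2⟩ := h.exists_inverse
  have key : ∀ s, mapSec φ h.smooth (mapSec ψ hψ s) = s :=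
    mapSec_mapSec_of_leftInverse ψ hψ φ h.smooth h2
  have := congrArg (mapSec φ h.smooth) (jacobi (mapSec ψ hψ a) (mapSec ψ hψ b) (mapSec ψ hψ c))
  simpa only [mapSec_add, mapSec_zero, h.map_bracket, key] using this

/-- Goes from target to source: each identity is checked after applying `φ`, which is injective on
sections and on fibres. -/
theorem IsLieAlgebroidIso.isLieAlgebroid {ρ : ∀ x, W x →ₗ[ℝ] TangentSpace 𝓘(ℝ, E) x}
    {br : Sec E G W → Sec E G W → Sec E G W}
    {ρ' : ∀ x, W' x →ₗ[ℝ] TangentSpace 𝓘(ℝ, E) x}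
    {br' : Sec E G' W' → Sec E G' W' → Sec E G' W'} {φ : ∀ x, W x →ₗ[ℝ] W' x}
    (h : IsLieAlgebroidIso ρ br ρ' br' φ) (h' : IsLieAlgebroid ρ' br') : IsLieAlgebroid ρ br := by
  obtain ⟨ψ, hψ, h1, h2⟩ := h.exists_inverse
  have inj : Function.Injective (mapSec φ h.smooth) :=
    Function.LeftInverse.injective (mapSec_mapSec_of_leftInverse φ h.smooth ψ hψ h1)
  have injx : ∀ x, Function.Injective (φ x) := fun x => Function.LeftInverse.injective (h1 x)
  refine ⟨?_, ?_, ?_, ?_, ?_, ?_, ?_, ?_⟩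
  · have hρ : ρ = fun x => ρ' x ∘ₗ φ x := by
      funext x
      ext v
      exact (h.map_anchor x v).symm
    rw [hρ]
    exact h'.anchor_smooth.comp h.smooth
  · intro a b c
    apply inj
    simp only [mapSec_add, h.map_bracket, h'.add_left]
  · intro t a b
    apply inj
    simp only [mapSec_smul, h.map_bracket, h'.smul_left]
  · intro a b c
    apply inj
    simp only [mapSec_add, h.map_bracket, h'.add_right]
  · intro t a b
    apply inj
    simp only [mapSec_smul, h.map_bracket, h'.smul_right]
  · intro a b
    apply inj
    simp only [mapSec_neg, h.map_bracket]
    exact h'.skew _ _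
  · intro a f b x
    apply injx x
    rw [map_add, map_smul, map_smul, ← mapSec_apply φ h.smooth, h.map_bracket, mapSec_fsmul,
      h'.anchored, anchorDeriv_mapSec φ h.smooth h.map_anchor, ← h.map_bracket]
    rfl
  · intro a b c
    apply inj
    simp only [mapSec_add, mapSec_zero, h.map_bracket, h'.jacobi]

theorem HasSignature.of_linearEquiv {U U' : Type*} [AddCommGroup U] [Module ℝ U]
    [AddCommGroup U'] [Module ℝ U'] {g : U →ₗ[ℝ] U →ₗ[ℝ] ℝ} {g' : U' →ₗ[ℝ] U' →ₗ[ℝ] ℝ} {p q : ℕ}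
    (h : HasSignature g' p q) (e : U ≃ₗ[ℝ] U') (he : ∀ u v, g' (e u) (e v) = g u v) :
    HasSignature g p q := by
  obtain ⟨b, hb⟩ := h
  refine ⟨b.map e.symm, fun i j => ?_⟩
  rw [← hb i j, ← he]
  simp

/-- The para-Kähler structures pull back along isomorphisms of Lie algebroids. -/
theorem IsLieAlgebroidIso.isParaKahler {ρ : ∀ x, W x →ₗ[ℝ] TangentSpace 𝓘(ℝ, E) x}
    {br : Sec E G W → Sec E G W → Sec E G W}
    {ρ' : ∀ x, W' x →ₗ[ℝ] TangentSpace 𝓘(ℝ, E) x}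
    {br' : Sec E G' W' → Sec E G' W' → Sec E G' W'} {φ : ∀ x, W x →ₗ[ℝ] W' x}
    (h : IsLieAlgebroidIso ρ br ρ' br' φ)
    {g : ∀ x, W x →ₗ[ℝ] W x →ₗ[ℝ] ℝ} {K : ∀ x, W x →ₗ[ℝ] W x}
    {g' : ∀ x, W' x →ₗ[ℝ] W' x →ₗ[ℝ] ℝ} {K' : ∀ x, W' x →ₗ[ℝ] W' x}
    (hg : ∀ x u v, g' x (φ x u) (φ x v) = g x u v) (hK : ∀ x u, K' x (φ x u) = φ x (K x u))
    (h' : IsParaKahler ρ' br' g' K') : IsParaKahler ρ br g K := by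
  obtain ⟨ψ, hψ, h1, h2⟩ := h.exists_inverse
  have inj : ∀ x, Function.Injective (φ x) := fun x => Function.LeftInverse.injective (h1 x)
  have hKs : IsBundleHom E G G K := by
    -- Smoothness of `K` is not assumed; it follows because `K` is the conjugate of `K'`.
    have : K = fun x => ψ x ∘ₗ (K' x ∘ₗ φ x) := by
      funext x
      ext v
      simp [hK, h1]
    rw [this]
    exact hψ.comp (h'.smooth.comp h.smooth)
  have hφψ : ∀ s, mapSec φ h.smooth (mapSec ψ hψ s) = s :=
    mapSec_mapSec_of_leftInverse ψ hψ φ h.smooth h2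
  have hψφ : ∀ s, mapSec ψ hψ (mapSec φ h.smooth s) = s :=
    mapSec_mapSec_of_leftInverse φ h.smooth ψ hψ h1
  refine ⟨h.isLieAlgebroid h'.lieAlgebroid, ⟨?_, ?_, ?_⟩, hKs, ?_, ?_, ?_⟩
  · intro x u v
    rw [← hg, h'.metric.symm, hg]
  · obtain ⟨p, q, hpq⟩ := h'.metric.signature
    refine ⟨p, q, fun x => (hpq x).of_linearEquiv
      (LinearEquiv.ofLinearMap (φ x) (ψ x) (LinearMap.ext (h2 x)) (LinearMap.ext (h1 x))) (hg x)⟩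
  · intro U a b hU ha hb
    have := h'.metric.smooth U (fun x => φ x (a x)) (fun x => φ x (b x)) hU
      (h.smooth.comp_contMDiffOn ha) (h.smooth.comp_contMDiffOn hb)
    simpa only [hg] using this
  · intro x v
    apply inj x
    rw [← hK, ← hK, h'.involutive]
  · intro x u v
    rw [← hg, ← hK, h'.skew, hK, hg]
  · obtain ⟨D, hD, hDK⟩ := h'.parallel
    have hKφ : ∀ a, mapSec φ h.smooth (mapSec K hKs a) =
        mapSec K' h'.smooth (mapSec φ h.smooth a) := by
      intro a
      ext x
      exact (hK x (a x)).symm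
    have hKψ : ∀ a, mapSec ψ hψ (mapSec K' h'.smooth a) =
        mapSec K hKs (mapSec ψ hψ a) := by
      intro a
      rw [← hφψ a, ← hKφ, hψφ, hψφ]
    -- The connection on the source is the conjugate of `D`; `hg` and `hK` turn the properties of
    -- `D` into those required.
    refine ⟨fun a b => mapSec ψ hψ (D (mapSec φ h.smooth a) (mapSec φ h.smooth b)),
      ⟨⟨?_, ?_, ?_, ?_, ?_⟩, ?_, ?_⟩, ?_⟩
    · intro a b c
      simp only [mapSec_add, hD.connection.add_left]
    · intro a b c
      simp only [mapSec_add, hD.connection.add_right]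
    · intro t a b
      simp only [mapSec_smul, hD.connection.smul_right]
    · intro f a b
      simp only [mapSec_fsmul, hD.connection.fsmul_left]
    · intro a f b x
      simp only [mapSec_fsmul, mapSec_apply, hD.connection.anchored, map_add, map_smul, h1,
        anchorDeriv_mapSec φ h.smooth h.map_anchor]
    · intro a b c x
      have := hD.metric (mapSec φ h.smooth a) (mapSec φ h.smooth b) (mapSec φ h.smooth c) x
      rw [anchorDeriv_mapSec φ h.smooth h.map_anchor] at this
      simp only [mapSec_apply, hg] at this
      rw [this, ← hg, ← hg]
      simp only [mapSec_apply, h2]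
    · intro a b
      rw [← mapSec_sub, hD.torsion_free, ← h.map_bracket, hψφ]
    · intro a b
      simp only [hKφ, hDK, hKψ]

end Transport

end ParaKahler

namespace ParaKahler

/-! ### Smoothness of the bundle maps on $A\oplus A^*$, and the signature of the neutral metric. -/

section Smoothness

variable {E : Type*} [NormedAddCommGroup E] [NormedSpace ℝ E] [FiniteDimensional ℝ E]
  {M : Type*} [TopologicalSpace M] [ChartedSpace E M] [IsManifold 𝓘(ℝ, E) ∞ M] [T2Space M]
  {F : Type*} [NormedAddCommGroup F] [NormedSpace ℝ F] [FiniteDimensional ℝ F]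
  {V : M → Type*} [TopologicalSpace (TotalSpace F V)]
  [∀ x, AddCommGroup (V x)] [∀ x, Module ℝ (V x)] [∀ x, TopologicalSpace (V x)]
  [FiberBundle F V] [VectorBundle ℝ F V] [ContMDiffVectorBundle ∞ F V 𝓘(ℝ, E)]
  {EN : Type*} [NormedAddCommGroup EN] [NormedSpace ℝ EN] {HN : Type*} [TopologicalSpace HN]
  {I : ModelWithCorners ℝ EN HN} {N : Type*} [TopologicalSpace N] [ChartedSpace HN N]
  {U : Set N} {y : N} {b : N → M}

/-- The trivializations of the sum are products, so coordinates split. The arbitrary base map `b`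
covers both sections (`b` the identity) and bundle homomorphisms (`b` the projection of a total
space). -/
theorem contMDiffWithinAt_phase {v : ∀ y, V (b y)} {α : ∀ y, V (b y) →L[ℝ] ℝ} :
    ContMDiffWithinAt I (𝓘(ℝ, E).prod 𝓘(ℝ, F × (F →L[ℝ] ℝ))) ∞
      (fun y => TotalSpace.mk' (F × (F →L[ℝ] ℝ)) (E := fun x : M => V x × (V x →L[ℝ] ℝ)) (b y)
        (v y, α y)) U y ↔
    ContMDiffWithinAt I (𝓘(ℝ, E).prod 𝓘(ℝ, F)) ∞ (fun y => TotalSpace.mk' F (b y) (v y)) U y ∧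
    ContMDiffWithinAt I (𝓘(ℝ, E).prod 𝓘(ℝ, F →L[ℝ] ℝ)) ∞
      (fun y => TotalSpace.mk' (F →L[ℝ] ℝ) (E := fun x : M => V x →L[ℝ] ℝ) (b y) (α y)) U y := by
  simp only [contMDiffWithinAt_totalSpace]
  constructor
  · rintro ⟨h, h'⟩
    exact ⟨⟨h, (ContinuousLinearMap.fst ℝ F (F →L[ℝ] ℝ)).contMDiff.contMDiffAt.comp_contMDiffWithinAt
      y h'⟩, h, (ContinuousLinearMap.snd ℝ F (F →L[ℝ] ℝ)).contMDiff.contMDiffAt.comp_contMDiffWithinAt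
      y h'⟩
  · rintro ⟨⟨h, h1⟩, -, h2⟩
    exact ⟨h, h1.prodMk_space h2⟩

theorem contMDiffWithinAt_pairing {v : ∀ y, V (b y)} {α : ∀ y, V (b y) →L[ℝ] ℝ}
    (hα : ContMDiffWithinAt I (𝓘(ℝ, E).prod 𝓘(ℝ, F →L[ℝ] ℝ)) ∞
      (fun y => TotalSpace.mk' (F →L[ℝ] ℝ) (E := fun x : M => V x →L[ℝ] ℝ) (b y) (α y)) U y)
    (hv : ContMDiffWithinAt I (𝓘(ℝ, E).prod 𝓘(ℝ, F)) ∞ (fun y => TotalSpace.mk' F (b y) (v y)) U y) :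
    ContMDiffWithinAt I 𝓘(ℝ, ℝ) ∞ (fun y => α y (v y)) U y := by
  have h := ContMDiffWithinAt.clm_bundle_apply (E₂ := Bundle.Trivial M ℝ) hα hv
  exact (contMDiffWithinAt_totalSpace.1 h).2

section Linear

variable {G : Type*} [NormedAddCommGroup G] [NormedSpace ℝ G]
  {W : M → Type*} [TopologicalSpace (TotalSpace G W)]
  [∀ x, AddCommGroup (W x)] [∀ x, Module ℝ (W x)] [∀ x, TopologicalSpace (W x)]
  [FiberBundle G W] [VectorBundle ℝ G W]

/-- Near `b y` the trivialization is linear on fibres, so the coordinate of a sum is the sum of the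
coordinates. -/
theorem contMDiffAt_bundle_add {v w : ∀ y, W (b y)}
    (hv : ContMDiffAt I (𝓘(ℝ, E).prod 𝓘(ℝ, G)) ∞ (fun y => TotalSpace.mk' G (b y) (v y)) y)
    (hw : ContMDiffAt I (𝓘(ℝ, E).prod 𝓘(ℝ, G)) ∞ (fun y => TotalSpace.mk' G (b y) (w y)) y) :
    ContMDiffAt I (𝓘(ℝ, E).prod 𝓘(ℝ, G)) ∞
      (fun y => TotalSpace.mk' G (b y) (v y + w y)) y := by
  rw [contMDiffAt_totalSpace] at hv hw ⊢
  refine ⟨hv.1, (hv.2.add hw.2).congr_of_eventuallyEq ?_⟩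
  have := hv.1.continuousAt.preimage_mem_nhds ((trivializationAt G W (b y)).open_baseSet.mem_nhds
    (FiberBundle.mem_baseSet_trivializationAt G W (b y)))
  filter_upwards [this] with z hz
  exact ((trivializationAt G W (b y)).linear ℝ hz).map_add _ _

theorem contMDiffAt_bundle_smul {f : N → ℝ} {v : ∀ y, W (b y)}
    (hf : ContMDiffAt I 𝓘(ℝ, ℝ) ∞ f y)
    (hv : ContMDiffAt I (𝓘(ℝ, E).prod 𝓘(ℝ, G)) ∞ (fun y => TotalSpace.mk' G (b y) (v y)) y) :
    ContMDiffAt I (𝓘(ℝ, E).prod 𝓘(ℝ, G)) ∞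
      (fun y => TotalSpace.mk' G (b y) (f y • v y)) y := by
  rw [contMDiffAt_totalSpace] at hv ⊢
  refine ⟨hv.1, (hf.smul hv.2).congr_of_eventuallyEq ?_⟩
  have := hv.1.continuousAt.preimage_mem_nhds ((trivializationAt G W (b y)).open_baseSet.mem_nhds
    (FiberBundle.mem_baseSet_trivializationAt G W (b y)))
  filter_upwards [this] with z hz
  exact ((trivializationAt G W (b y)).linear ℝ hz).map_smul _ _

theorem contMDiffAt_bundle_sub {v w : ∀ y, W (b y)}
    (hv : ContMDiffAt I (𝓘(ℝ, E).prod 𝓘(ℝ, G)) ∞ (fun y => TotalSpace.mk' G (b y) (v y)) y)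
    (hw : ContMDiffAt I (𝓘(ℝ, E).prod 𝓘(ℝ, G)) ∞ (fun y => TotalSpace.mk' G (b y) (w y)) y) :
    ContMDiffAt I (𝓘(ℝ, E).prod 𝓘(ℝ, G)) ∞
      (fun y => TotalSpace.mk' G (b y) (v y - w y)) y := by
  have := contMDiffAt_bundle_add hv (contMDiffAt_bundle_smul (contMDiffAt_const (c := (-1 : ℝ))) hw)
  simpa [sub_eq_add_neg] using this

theorem contMDiffAt_bundle_sum {n : ℕ} {v : Fin n → ∀ y, W (b y)}
    (hb : ContMDiffAt I 𝓘(ℝ, E) ∞ b y)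
    (hv : ∀ i, ContMDiffAt I (𝓘(ℝ, E).prod 𝓘(ℝ, G)) ∞
      (fun y => TotalSpace.mk' G (b y) (v i y)) y) :
    ContMDiffAt I (𝓘(ℝ, E).prod 𝓘(ℝ, G)) ∞
      (fun y => TotalSpace.mk' G (b y) (∑ i, v i y)) y := by
  induction n with
  | zero =>
    simp only [Finset.univ_eq_empty, Finset.sum_empty]
    -- With no summand left, the smoothness of `b` can only come from `hb`.
    exact (Bundle.contMDiff_zeroSection ℝ W (IB := 𝓘(ℝ, E)) (n := ∞)).contMDiffAt.comp y hb
  | succ n ih =>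
    simp only [Fin.sum_univ_succ]
    exact contMDiffAt_bundle_add (hv 0) (ih fun i => hv i.succ)

end Linear

/-- `r_#` is a homomorphism of vector bundles. -/
theorem TensorSec.isBundleHom_sharp (r : TensorSec E F V) :
    IsBundleHom E (F →L[ℝ] ℝ) F r.sharp := by
  intro p
  obtain ⟨n, s, c, χ, hχ, h⟩ := exists_frame (E := E) (F := F) (V := V) p.1
  have hproj : ContMDiffAt (𝓘(ℝ, E).prod 𝓘(ℝ, F →L[ℝ] ℝ)) 𝓘(ℝ, E) ∞
      (fun q : TotalSpace (F →L[ℝ] ℝ) (fun x : M => V x →L[ℝ] ℝ) => q.1) p :=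
    (contMDiffAt_totalSpace.1 contMDiffAt_id).1
  -- Near `p` a covector expands as $\alpha=\sum_i\alpha(s_i)c_i$, so
  -- $r_\#\alpha=\sum_i\alpha(s_i)\,r_\#(c_i)$. The cut-off frame is global, so that `sharpSec`
  -- applies to each $c_i$.
  have key : ContMDiffAt (𝓘(ℝ, E).prod 𝓘(ℝ, F →L[ℝ] ℝ)) (𝓘(ℝ, E).prod 𝓘(ℝ, F)) ∞
      (fun q : TotalSpace (F →L[ℝ] ℝ) (fun x : M => V x →L[ℝ] ℝ) =>
        TotalSpace.mk' F (E := V) q.1 (∑ i, q.2 (s i q.1) • r.sharpSec (c i) q.1)) p := by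
    refine contMDiffAt_bundle_sum hproj fun i => contMDiffAt_bundle_smul ?_ ?_
    · exact contMDiffWithinAt_pairing (N := TotalSpace (F →L[ℝ] ℝ) fun x : M => V x →L[ℝ] ℝ)
        (U := Set.univ) (b := fun q => q.1) (α := fun q => q.2)
        (v := fun q => s i q.1) contMDiffWithinAt_id
        (((s i).contMDiff p.1).comp p hproj)
    · exact ((r.sharpSec (c i)).contMDiff p.1).comp p hproj
  refine key.congr_of_eventuallyEq ?_
  filter_upwards [hproj.continuousAt.preimage_mem_nhds hχ] with q hq
  have hq : χ q.1 = 1 := hq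
  have h1 : q.2 = ∑ i, q.2 (s i q.1) • c i q.1 := by
    ext v
    have := congrArg q.2 (h q.1 v)
    rw [hq, one_smul] at this
    rw [← this]
    simp [mul_comm]
  congr 1
  conv_lhs => rw [h1]
  simp only [map_sum, map_smul]
  rfl

variable (E V) in
theorem isBundleHom_phaseFst :
    IsBundleHom E (F × (F →L[ℝ] ℝ)) F (W := fun x : M => V x × (V x →L[ℝ] ℝ))
      (fun x => LinearMap.fst ℝ (V x) (V x →L[ℝ] ℝ)) := fun _ =>
  (contMDiffWithinAt_phase
    (N := TotalSpace (F × (F →L[ℝ] ℝ)) fun x : M => V x × (V x →L[ℝ] ℝ))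
    (U := Set.univ) (b := fun q => q.1) (v := fun q => q.2.1) (α := fun q => q.2.2).1
    contMDiffWithinAt_id).1

variable (E V) in
theorem isBundleHom_phaseSnd :
    IsBundleHom E (F × (F →L[ℝ] ℝ)) (F →L[ℝ] ℝ) (W := fun x : M => V x × (V x →L[ℝ] ℝ))
      (W' := fun x : M => V x →L[ℝ] ℝ)
      (fun x => LinearMap.snd ℝ (V x) (V x →L[ℝ] ℝ)) := fun _ =>
  (contMDiffWithinAt_phase
    (N := TotalSpace (F × (F →L[ℝ] ℝ)) fun x : M => V x × (V x →L[ℝ] ℝ))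
    (U := Set.univ) (b := fun q => q.1) (v := fun q => q.2.1) (α := fun q => q.2.2).1
    contMDiffWithinAt_id).2

theorem isBundleHom_phaseK :
    IsBundleHom E (F × (F →L[ℝ] ℝ)) (F × (F →L[ℝ] ℝ)) (W := fun x : M => V x × (V x →L[ℝ] ℝ))
      (W' := fun x : M => V x × (V x →L[ℝ] ℝ)) (fun _ => phaseK) := fun p => by
  have h := contMDiffAt_bundle_smul (contMDiffAt_const (c := (-1 : ℝ)))
    (isBundleHom_phaseSnd E V p)
  simp only [neg_smul, one_smul] at h
  exact contMDiffWithinAt_phase.2 ⟨isBundleHom_phaseFst E V p, h⟩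

theorem TensorSec.isBundleHom_xi (r : TensorSec E F V) :
    IsBundleHom E (F × (F →L[ℝ] ℝ)) (F × (F →L[ℝ] ℝ)) (W := fun x : M => V x × (V x →L[ℝ] ℝ))
      (W' := fun x : M => V x × (V x →L[ℝ] ℝ)) r.xi := fun p =>
  contMDiffWithinAt_phase.2 ⟨contMDiffAt_bundle_sub (isBundleHom_phaseFst E V p)
    (r.isBundleHom_sharp.comp (isBundleHom_phaseSnd E V) p), isBundleHom_phaseSnd E V p⟩

/-- `X + α ↦ X + r_#(α) + α`, the inverse of `ξ`. -/
def TensorSec.xiInv (r : TensorSec E F V) (x : M) :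
    V x × (V x →L[ℝ] ℝ) →ₗ[ℝ] V x × (V x →L[ℝ] ℝ) :=
  (LinearMap.fst ℝ _ _ + r.sharp x ∘ₗ LinearMap.snd ℝ _ _).prod (LinearMap.snd ℝ _ _)

theorem TensorSec.isBundleHom_xiInv (r : TensorSec E F V) :
    IsBundleHom E (F × (F →L[ℝ] ℝ)) (F × (F →L[ℝ] ℝ)) (W := fun x : M => V x × (V x →L[ℝ] ℝ))
      (W' := fun x : M => V x × (V x →L[ℝ] ℝ)) r.xiInv := fun p =>
  contMDiffWithinAt_phase.2 ⟨contMDiffAt_bundle_add (isBundleHom_phaseFst E V p)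
    (r.isBundleHom_sharp.comp (isBundleHom_phaseSnd E V) p), isBundleHom_phaseSnd E V p⟩

theorem LeftSymmetricAlgebroid.isBundleHom_anchorExact (L : LeftSymmetricAlgebroid E F V)
    (r : TensorSec E F V) :
    IsBundleHom E (F × (F →L[ℝ] ℝ)) E (W := fun x : M => V x × (V x →L[ℝ] ℝ))
      (L.anchorExact r) := by
  have h : IsBundleHom E (F × (F →L[ℝ] ℝ)) F (W := fun x : M => V x × (V x →L[ℝ] ℝ))
      (fun x => LinearMap.fst ℝ _ _ + r.sharp x ∘ₗ LinearMap.snd ℝ _ _) := fun p =>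
    contMDiffAt_bundle_add (isBundleHom_phaseFst E V p)
      (r.isBundleHom_sharp.comp (isBundleHom_phaseSnd E V) p)
  have h2 : L.anchorExact r = fun x => L.anchor x ∘ₗ
      (LinearMap.fst ℝ _ _ + r.sharp x ∘ₗ LinearMap.snd ℝ _ _) := by
    funext x
    ext v <;> simp [anchorExact]
  rw [h2]
  exact L.anchor_smooth.comp h

theorem hasSignature_phaseMetric_normed (F : Type*) [NormedAddCommGroup F] [NormedSpace ℝ F]
    [FiniteDimensional ℝ F] :
    HasSignature (phaseMetric (U := F)) (finrank ℝ F) (finrank ℝ F) := by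
  let e := finBasis ℝ F
  let c : Fin (finrank ℝ F) → F →L[ℝ] ℝ := fun i => LinearMap.toContinuousLinearMap (e.coord i)
  have hc : ∀ i j, c i (e j) = if i = j then 1 else 0 := by
    intro i j
    simp [c, Finsupp.single_apply, eq_comm]
  -- The vectors $e_i\pm\frac12e^i$ are orthogonal, and the factor $\frac12$ makes their squares
  -- exactly $\pm1$.
  let v : Fin (finrank ℝ F) ⊕ Fin (finrank ℝ F) → F × (F →L[ℝ] ℝ) :=
    Sum.elim (fun i => (e i, (1 / 2 : ℝ) • c i)) (fun i => (e i, -((1 / 2 : ℝ) • c i)))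
  have hv : ∀ i j, phaseMetric (v i) (v j) =
      if i = j then Sum.elim (fun _ => 1) (fun _ => -1) i else (0 : ℝ) := by
    rintro (i | i) (j | j) <;> simp [v, phaseMetric, hc, eq_comm (a := j)] <;>
      split_ifs <;> norm_num
  -- Pairing a vanishing combination with `v i` leaves plus or minus its `i`-th coefficient.
  have hli : LinearIndependent ℝ v := by
    rw [Fintype.linearIndependent_iff]
    intro g hg i
    have := congrArg (fun w => phaseMetric w (v i)) hg
    simp only [map_sum, map_smul, LinearMap.sum_apply, LinearMap.smul_apply, hv] at this
    rcases i with i | i <;> simpa using this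
  have hcard : Fintype.card (Fin (finrank ℝ F) ⊕ Fin (finrank ℝ F)) =
      finrank ℝ (F × (F →L[ℝ] ℝ)) := by
    rw [finrank_prod, ← (LinearMap.toContinuousLinearMap (𝕜 := ℝ) (E := F) (F' := ℝ)).finrank_eq,
      Subspace.dual_finrank_eq]
    simp
  refine ⟨basisOfLinearIndependentOfCardEqFinrank' v hli hcard, fun i j => ?_⟩
  simp only [coe_basisOfLinearIndependentOfCardEqFinrank', hv]

/-- The fibres of `V` carry a topology but no norm, so the computation is made in the model `F` and
moved by `e` together with its contragredient, which preserve the pairing. -/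
theorem hasSignature_phaseMetric {U : Type*} [AddCommGroup U] [Module ℝ U] [TopologicalSpace U]
    (e : U ≃L[ℝ] F) : HasSignature (phaseMetric (U := U)) (finrank ℝ F) (finrank ℝ F) := by
  refine (hasSignature_phaseMetric_normed F).of_linearEquiv
    (e.toLinearEquiv.prodCongr
      { toFun := fun α => α ∘L (e.symm : F →L[ℝ] U)
        invFun := fun α => α ∘L (e : U →L[ℝ] F)
        map_add' := fun α β => by ext; simp
        map_smul' := fun t α => by ext; simp
        left_inv := fun α => by ext; simp
        right_inv := fun α => by ext; simp }) fun u v => ?_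
  simp [phaseMetric]

theorem isPseudoRiemannianMetric_phaseMetric :
    IsPseudoRiemannianMetric E (F × (F →L[ℝ] ℝ)) (W := fun x : M => V x × (V x →L[ℝ] ℝ))
      (fun _ => phaseMetric) := by
  refine ⟨fun x u v => ?_, ⟨_, _, fun x => hasSignature_phaseMetric
    ((trivializationAt F V x).continuousLinearEquivAt ℝ x
      (FiberBundle.mem_baseSet_trivializationAt F V x))⟩, fun U a b hU ha hb x hx => ?_⟩
  · simp [phaseMetric, add_comm]
  · have ha' := contMDiffWithinAt_phase.1 (ha x hx)
    have hb' := contMDiffWithinAt_phase.1 (hb x hx)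
    exact (contMDiffWithinAt_pairing ha'.2 hb'.1).add (contMDiffWithinAt_pairing hb'.2 ha'.1)

end Smoothness

end ParaKahler

namespace ParaKahler

/-! ### Calculus of $S$, $S^*$, $T$ and $\Delta(r)$. -/

section Algebra

variable {E : Type*} [NormedAddCommGroup E] [NormedSpace ℝ E] [FiniteDimensional ℝ E]
  {M : Type*} [TopologicalSpace M] [ChartedSpace E M] [IsManifold 𝓘(ℝ, E) ∞ M] [T2Space M]
  {F : Type*} [NormedAddCommGroup F] [NormedSpace ℝ F] [FiniteDimensional ℝ F]
  {V : M → Type*} [TopologicalSpace (TotalSpace F V)]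
  [∀ x, AddCommGroup (V x)] [∀ x, Module ℝ (V x)] [∀ x, TopologicalSpace (V x)]
  [FiberBundle F V] [VectorBundle ℝ F V] [ContMDiffVectorBundle ∞ F V 𝓘(ℝ, E)]

theorem coSec_ext {α β : CoSec E F V} (h : ∀ (X : Sec E F V) x, α x (X x) = β x (X x)) :
    α = β := by
  ext x v
  obtain ⟨X, rfl⟩ := exists_sec_eq (E := E) (F := F) x v
  exact h X x

theorem sec_ext {X Y : Sec E F V} (h : ∀ (α : CoSec E F V) x, α x (X x) = α x (Y x)) : X = Y := by
  ext x
  obtain ⟨n, s, c, χ, hχ, hs⟩ := exists_frame (E := E) (F := F) (V := V) x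
  have h1 := hs x (X x)
  have h2 := hs x (Y x)
  simp only [h] at h1
  have h3 : χ x = 1 := hχ.self_of_nhds
  rw [h3, one_smul] at h1 h2
  exact h1.symm.trans h2

theorem phaseSec_ext {a b : PhaseSec E F V} (h1 : phaseFst a = phaseFst b)
    (h2 : phaseSnd a = phaseSnd b) : a = b := by
  ext x : 1
  exact Prod.ext (DFunLike.congr_fun h1 x) (DFunLike.congr_fun h2 x)

theorem phaseFst_mk (X : Sec E F V) (α : CoSec E F V) : phaseFst (phaseMk X α) = X := rfl

theorem phaseSnd_mk (X : Sec E F V) (α : CoSec E F V) : phaseSnd (phaseMk X α) = α := rfl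

theorem phaseFst_add (a b : PhaseSec E F V) : phaseFst (a + b) = phaseFst a + phaseFst b := rfl

theorem phaseSnd_add (a b : PhaseSec E F V) : phaseSnd (a + b) = phaseSnd a + phaseSnd b := rfl

theorem phaseFst_sub (a b : PhaseSec E F V) : phaseFst (a - b) = phaseFst a - phaseFst b := rfl

theorem phaseSnd_sub (a b : PhaseSec E F V) : phaseSnd (a - b) = phaseSnd a - phaseSnd b := rfl

theorem phaseFst_zero : phaseFst (0 : PhaseSec E F V) = 0 := rfl

theorem phaseSnd_zero : phaseSnd (0 : PhaseSec E F V) = 0 := rfl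

theorem phaseFst_fsmul (f : C^∞⟮𝓘(ℝ, E), M; ℝ⟯) (a : PhaseSec E F V) :
    phaseFst (fsmul f a) = fsmul f (phaseFst a) := rfl

theorem phaseSnd_fsmul (f : C^∞⟮𝓘(ℝ, E), M; ℝ⟯) (a : PhaseSec E F V) :
    phaseSnd (fsmul f a) = fsmul f (phaseSnd a) := rfl

theorem anchorDeriv_sub (ρ : ∀ x, V x →ₗ[ℝ] TangentSpace 𝓘(ℝ, E) x) (X : Sec E F V) (f g : M → ℝ)
    (hf : ContMDiff 𝓘(ℝ, E) 𝓘(ℝ, ℝ) ∞ f) (hg : ContMDiff 𝓘(ℝ, E) 𝓘(ℝ, ℝ) ∞ g) (x : M) :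
    anchorDeriv ρ X (fun y => f y - g y) x = anchorDeriv ρ X f x - anchorDeriv ρ X g x := by
  have h := anchorDeriv_add ρ X (fun y => f y - g y) g (hf.sub hg) hg x
  simp only [sub_add_cancel] at h
  linarith

theorem anchorDeriv_const {G : Type*} [NormedAddCommGroup G] [NormedSpace ℝ G]
    {W : M → Type*} [TopologicalSpace (TotalSpace G W)]
    [∀ x, AddCommGroup (W x)] [∀ x, Module ℝ (W x)] [∀ x, TopologicalSpace (W x)]
    [FiberBundle G W] [VectorBundle ℝ G W]
    (ρ : ∀ x, W x →ₗ[ℝ] TangentSpace 𝓘(ℝ, E) x) (X : Sec E G W) (t : ℝ) (x : M) :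
    anchorDeriv ρ X (fun _ => t) x = 0 := by
  simp [anchorDeriv, mvfderiv_const]

theorem anchorDeriv_eq_zero (ρ : ∀ x, V x →ₗ[ℝ] TangentSpace 𝓘(ℝ, E) x) (X : Sec E F V)
    (f : M → ℝ) (x : M) (h : ρ x (X x) = 0) : anchorDeriv ρ X f x = 0 := by
  simp only [anchorDeriv, h, map_zero]

theorem evalTensor_comm {U : Type*} [AddCommGroup U] [Module ℝ U] [TopologicalSpace U]
    (t : U ⊗[ℝ] U) (α β : U →L[ℝ] ℝ) :
    evalTensor (TensorProduct.comm ℝ U U t) α β = evalTensor t β α := by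
  simp only [evalTensor]
  induction t using TensorProduct.induction_on with
  | zero => simp
  | tmul u v => simp [mul_comm]
  | add s t hs ht => simp only [map_add, hs, ht]

theorem evalTensor_skewPart {U : Type*} [AddCommGroup U] [Module ℝ U] [TopologicalSpace U]
    (t : U ⊗[ℝ] U) (α β : U →L[ℝ] ℝ) :
    evalTensor (skewPart t) α β = (1 / 2) * (evalTensor t α β - evalTensor t β α) := by
  rw [← evalTensor_comm t α β]
  simp [evalTensor, skewPart]

theorem evalTensor_symmPart {U : Type*} [AddCommGroup U] [Module ℝ U] [TopologicalSpace U]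
    (t : U ⊗[ℝ] U) (α β : U →L[ℝ] ℝ) :
    evalTensor (symmPart t) α β = (1 / 2) * (evalTensor t α β + evalTensor t β α) := by
  rw [← evalTensor_comm t α β]
  simp [evalTensor, symmPart, mul_add]

namespace TensorSec

variable (r : TensorSec E F V)

theorem sharpSec_apply (α : CoSec E F V) (x : M) : r.sharpSec α x = r.sharp x (α x) := rfl

theorem sharpSec_add (α β : CoSec E F V) : r.sharpSec (α + β) = r.sharpSec α + r.sharpSec β := by
  ext x
  exact map_add (r.sharp x) _ _

theorem sharpSec_sub (α β : CoSec E F V) : r.sharpSec (α - β) = r.sharpSec α - r.sharpSec β := by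
  ext x
  exact map_sub (r.sharp x) _ _

theorem sharpSec_fsmul (f : C^∞⟮𝓘(ℝ, E), M; ℝ⟯) (α : CoSec E F V) :
    r.sharpSec (fsmul f α) = fsmul f (r.sharpSec α) := by
  ext x
  exact map_smul (r.sharp x) _ _

end TensorSec

namespace LeftSymmetricAlgebroid

variable (L : LeftSymmetricAlgebroid E F V)

theorem prod_sub_left (X Y Z : Sec E F V) : L.prod (X - Y) Z = L.prod X Z - L.prod Y Z :=
  map_sub (AddMonoidHom.mk' (fun X => L.prod X Z) fun X Y => L.rightAnchored.add_left X Y Z) X Y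

theorem prod_sub_right (X Y Z : Sec E F V) : L.prod X (Y - Z) = L.prod X Y - L.prod X Z :=
  map_sub (AddMonoidHom.mk' (L.prod X) (L.rightAnchored.add_right X)) Y Z

theorem dual_map_add_left (X Y : Sec E F V) (α : CoSec E F V) :
    L.dual (X + Y) α = L.dual X α + L.dual Y α := by
  ext1 x
  exact L.dual_add_left X Y α x

theorem dual_map_add_right (X : Sec E F V) (α β : CoSec E F V) :
    L.dual X (α + β) = L.dual X α + L.dual X β := by
  ext1 x
  exact L.dual_add_right X α β x

theorem dual_sub_left (X Y : Sec E F V) (α : CoSec E F V) :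
    L.dual (X - Y) α = L.dual X α - L.dual Y α :=
  map_sub (AddMonoidHom.mk' (fun X => L.dual X α) fun X Y => L.dual_map_add_left X Y α) X Y

theorem dual_sub_right (X : Sec E F V) (α β : CoSec E F V) :
    L.dual X (α - β) = L.dual X α - L.dual X β :=
  map_sub (AddMonoidHom.mk' (L.dual X) (L.dual_map_add_right X)) α β

theorem bracket_add_left (X Y Z : Sec E F V) :
    L.bracket (X + Y) Z = L.bracket X Z + L.bracket Y Z := by
  simp only [bracket, L.rightAnchored.add_left, L.rightAnchored.add_right]
  abel

theorem bracket_add_right (X Y Z : Sec E F V) :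
    L.bracket X (Y + Z) = L.bracket X Y + L.bracket X Z := by
  simp only [bracket, L.rightAnchored.add_left, L.rightAnchored.add_right]
  abel

theorem bracket_sub_left (X Y Z : Sec E F V) :
    L.bracket (X - Y) Z = L.bracket X Z - L.bracket Y Z := by
  simp only [bracket, prod_sub_left, prod_sub_right]
  abel

theorem bracket_sub_right (X Y Z : Sec E F V) :
    L.bracket X (Y - Z) = L.bracket X Y - L.bracket X Z := by
  simp only [bracket, prod_sub_left, prod_sub_right]
  abel

theorem bracket_swap (X Y : Sec E F V) : L.bracket X Y = -L.bracket Y X := by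
  simp only [bracket]
  abel

/-- This is the first Bianchi identity for a flat product: vanishing curvature replaces each
$S_{[X,Y]_S}Z$ by second-order terms that cancel in the cyclic sum. -/
theorem bracket_jacobi (X Y Z : Sec E F V) :
    L.bracket (L.bracket X Y) Z + L.bracket (L.bracket Y Z) X + L.bracket (L.bracket Z X) Y
      = 0 := by
  have h1 := L.curvature_eq_zero X Y Z
  have h2 := L.curvature_eq_zero Y Z X
  have h3 := L.curvature_eq_zero Z X Y
  rw [sub_eq_zero] at h1 h2 h3
  simp only [bracket, ← h1, ← h2, ← h3, prod_sub_right]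
  abel

/-- The smooth function `ρ(X).f`. -/
def anchorFun (X : Sec E F V) (f : C^∞⟮𝓘(ℝ, E), M; ℝ⟯) : C^∞⟮𝓘(ℝ, E), M; ℝ⟯ :=
  ⟨anchorDeriv L.anchor X f, contMDiff_anchorDeriv _ L.anchor_smooth X f f.contMDiff⟩

theorem prod_fsmul_right (X : Sec E F V) (f : C^∞⟮𝓘(ℝ, E), M; ℝ⟯) (Y : Sec E F V) :
    L.prod X (fsmul f Y) = fsmul f (L.prod X Y) + fsmul (L.anchorFun X f) Y := by
  ext x
  exact L.rightAnchored.anchored X f Y x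

/-- The anchor of a left symmetric algebroid is compatible with the brackets. -/
theorem anchorDeriv_bracket (X Y : Sec E F V) (f : C^∞⟮𝓘(ℝ, E), M; ℝ⟯) (x : M) :
    anchorDeriv L.anchor (L.bracket X Y) f x =
      anchorDeriv L.anchor X (anchorDeriv L.anchor Y f) x
        - anchorDeriv L.anchor Y (anchorDeriv L.anchor X f) x := by
  -- The identity is read off as a coefficient of a section that does not vanish at `x`. If the
  -- fibre is zero there is no such section, but then every term is zero.
  by_cases hV : ∃ v : V x, v ≠ 0
  · obtain ⟨v, hv⟩ := hV
    obtain ⟨Z, rfl⟩ := exists_sec_eq (E := E) (F := F) x v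
    have h1 := DFunLike.congr_fun (L.curvature_eq_zero X Y (fsmul f Z)) x
    have h2 := DFunLike.congr_fun (L.curvature_eq_zero X Y Z) x
    simp only [prod_fsmul_right, L.rightAnchored.add_right, ContMDiffSection.coe_sub,
      ContMDiffSection.coe_add, Pi.add_apply, Pi.sub_apply, fsmul_apply,
      ContMDiffSection.coe_zero, Pi.zero_apply] at h1 h2
    -- The curvature on `fsmul f Z` minus `f` times the curvature on `Z` leaves only this multiple
    -- of `Z x`.
    have h3 : (anchorDeriv L.anchor X (anchorDeriv L.anchor Y f) x
        - anchorDeriv L.anchor Y (anchorDeriv L.anchor X f) x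
        - anchorDeriv L.anchor (L.bracket X Y) f x) • Z x = 0 := by
      have e1 : ∀ g W, (L.anchorFun W g : C^∞⟮𝓘(ℝ, E), M; ℝ⟯) x = anchorDeriv L.anchor W g x :=
        fun _ _ => rfl
      have e2 : ∀ g W, ((L.anchorFun W g : C^∞⟮𝓘(ℝ, E), M; ℝ⟯) : M → ℝ) = anchorDeriv L.anchor W g :=
        fun _ _ => rfl
      simp only [e1, e2] at h1
      have h4 := congrArg (f x • ·) h2
      simp only [smul_zero] at h4
      rw [← sub_eq_zero.2 (h1.trans h4.symm), bracket]
      module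
    rcases smul_eq_zero.1 h3 with h | h
    · linarith
    · exact absurd h hv
  · push Not at hV
    have h0 : ∀ (W : Sec E F V) (g : M → ℝ), anchorDeriv L.anchor W g x = 0 := fun W g =>
      anchorDeriv_eq_zero _ _ _ _ (by rw [hV (W x), map_zero])
    simp only [h0, sub_zero]

theorem dual_apply_fun (X : Sec E F V) (α : CoSec E F V) (Y : Sec E F V) :
    (fun y => L.dual X α y (Y y)) =
      fun y => anchorDeriv L.anchor X (pairFun α Y) y - α y (L.prod X Y y) :=
  funext (L.dual_apply X α Y)

/-- `S*` is a representation of the Lie algebroid `(V, ρ, [ , ]_S)`. -/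
theorem dual_bracket (X Y : Sec E F V) (α : CoSec E F V) :
    L.dual (L.bracket X Y) α = L.dual X (L.dual Y α) - L.dual Y (L.dual X α) := by
  refine coSec_ext fun Z x => ?_
  have hs : ∀ W, ContMDiff 𝓘(ℝ, E) 𝓘(ℝ, ℝ) ∞ (anchorDeriv L.anchor W (pairFun α Z)) :=
    fun W => contMDiff_anchorDeriv _ L.anchor_smooth W _ (contMDiff_pair α Z)
  have h := L.anchorDeriv_bracket X Y (pairFun α Z) x
  have hc := congrArg (α x) (DFunLike.congr_fun (L.curvature_eq_zero X Y Z) x)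
  simp only [ContMDiffSection.coe_sub, Pi.sub_apply, map_sub, ContMDiffSection.coe_zero,
    Pi.zero_apply, map_zero] at hc
  have e : ∀ W, (fun y => α y (W y)) = pairFun α W := fun _ => rfl
  simp only [ContMDiffSection.coe_sub, Pi.sub_apply, sub_apply]
  rw [L.dual_apply _ _ Z, L.dual_apply X _ Z, L.dual_apply Y _ Z, L.dual_apply_fun Y α Z,
    L.dual_apply_fun X α Z, anchorDeriv_sub _ _ _ _ (hs Y) (contMDiff_pair α _),
    anchorDeriv_sub _ _ _ _ (hs X) (contMDiff_pair α _), L.dual_apply Y α, L.dual_apply X α]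
  simp only [e]
  -- The cross terms such as $\rho(X).\langle\alpha,S_YZ\rangle$ cancel in the commutator; what
  -- remains is `h` and the pairing `hc` of $\alpha$ with the curvature.
  rw [h, bracket]
  linarith

variable (r : TensorSec E F V)

/-- The covariant derivative of `r_#`: `S_X(r_#(α)) - r_#(S*_X α)`. -/
def sharpDeriv (X : Sec E F V) (α : CoSec E F V) : Sec E F V :=
  L.prod X (r.sharpSec α) - r.sharpSec (L.dual X α)

/-- The right side is the first three terms in the definition of $T$, so $T_\alpha\beta$ is a
tensorial term plus $S^*_{r_\#\alpha}\beta$. -/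
theorem apply_sharpDeriv (X : Sec E F V) (α β : CoSec E F V) (x : M) :
    β x (L.sharpDeriv r X α x) =
      anchorDeriv L.anchor X (fun y => evalTensor (r.toFun y) (α y) (β y)) x
      - evalTensor (r.toFun x) (L.dual X α x) (β x)
      - evalTensor (r.toFun x) (α x) (L.dual X β x) := by
  have h := L.dual_apply X β (r.sharpSec α) x
  simp only [← TensorSec.apply_sharp, sharpDeriv, ContMDiffSection.coe_sub, Pi.sub_apply, map_sub]
  simp only [TensorSec.sharpSec_apply] at h ⊢
  linarith

theorem sharpDeriv_fsmul_right (X : Sec E F V) (f : C^∞⟮𝓘(ℝ, E), M; ℝ⟯) (α : CoSec E F V) :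
    L.sharpDeriv r X (fsmul f α) = fsmul f (L.sharpDeriv r X α) := by
  ext x
  simp only [sharpDeriv, r.sharpSec_fsmul, ContMDiffSection.coe_sub, Pi.sub_apply,
    L.rightAnchored.anchored, fsmul_apply, TensorSec.sharpSec_apply, dual_fsmul_right, map_add,
    map_smul]
  module

theorem sharpDeriv_add_right (X : Sec E F V) (α β : CoSec E F V) :
    L.sharpDeriv r X (α + β) = L.sharpDeriv r X α + L.sharpDeriv r X β := by
  simp only [sharpDeriv, r.sharpSec_add, L.rightAnchored.add_right, dual_map_add_right]
  abel

theorem dualProd_apply' (α β : CoSec E F V) (X : Sec E F V) (x : M) :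
    L.dualProd r α β x (X x) = β x (L.sharpDeriv r X α x) + L.dual (r.sharpSec α) β x (X x) := by
  rw [dualProd_apply, apply_sharpDeriv]

theorem dualProd_map_add_right (α β γ : CoSec E F V) :
    L.dualProd r α (β + γ) = L.dualProd r α β + L.dualProd r α γ := by
  ext1 x
  exact L.dualProd_add_right r α β γ x

theorem dualProd_map_add_left (α β γ : CoSec E F V) :
    L.dualProd r (α + β) γ = L.dualProd r α γ + L.dualProd r β γ := by
  refine coSec_ext fun X x => ?_
  simp only [ContMDiffSection.coe_add, Pi.add_apply, add_apply, dualProd_apply',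
    sharpDeriv_add_right, r.sharpSec_add, dual_map_add_left, map_add]
  ring

theorem dualProd_fsmul_left (f : C^∞⟮𝓘(ℝ, E), M; ℝ⟯) (α β : CoSec E F V) :
    L.dualProd r (fsmul f α) β = fsmul f (L.dualProd r α β) := by
  refine coSec_ext fun X x => ?_
  simp only [fsmul_apply, smul_apply, dualProd_apply', sharpDeriv_fsmul_right, r.sharpSec_fsmul,
    dual_fsmul_left, map_smul, smul_eq_mul]
  ring

/-- In $\langle\beta,T^*_\alpha Y\rangle$ the derivative of $\langle\beta,Y\rangle$ along
$r_\#\alpha$ cancels against the one inside $S^*_{r_\#\alpha}\beta$. The formula holds for every $r$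
and removes $T^*$ from later computations. -/
theorem dualProdDual_eq (α : CoSec E F V) (Y : Sec E F V) :
    L.dualProdDual r α Y = L.bracket (r.sharpSec α) Y + r.sharpSec (L.dual Y α) := by
  refine sec_ext fun β x => ?_
  rw [apply_dualProdDual, dualProd_apply', dual_apply]
  simp only [bracket, sharpDeriv, ContMDiffSection.coe_add, ContMDiffSection.coe_sub,
    Pi.add_apply, Pi.sub_apply, map_add, map_sub]
  ring

end LeftSymmetricAlgebroid

/-! ### Consequences of the quasi $\mathbb S$-matrix conditions, up to the Jacobi identity. -/

namespace LeftSymmetricAlgebroid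

variable {L : LeftSymmetricAlgebroid E F V} {r : TensorSec E F V}

/-- The symmetric part of `r` is the only one that contributes to the derivative of `r_#`. -/
theorem IsQuasiSMatrix.apply_sharpDeriv_comm (hr : L.IsQuasiSMatrix r) (X : Sec E F V)
    (α β : CoSec E F V) (x : M) :
    β x (L.sharpDeriv r X α x) = α x (L.sharpDeriv r X β x) := by
  have h := hr.skew_parallel X α β x
  have hs : ContMDiff 𝓘(ℝ, E) 𝓘(ℝ, ℝ) ∞
      (fun y => evalTensor (r.toFun y) (α y) (β y) - evalTensor (r.toFun y) (β y) (α y)) :=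
    (r.smooth α β).sub (r.smooth β α)
  simp only [evalTensor_skewPart] at h
  rw [anchorDeriv_mul _ _ _ _ (contMDiff_const (c := (1 / 2 : ℝ))) hs, anchorDeriv_const,
    anchorDeriv_sub _ _ _ _ (r.smooth α β) (r.smooth β α)] at h
  rw [apply_sharpDeriv, apply_sharpDeriv]
  linarith

/-- The tensorial part of $T$ is symmetric by `apply_sharpDeriv_comm`, so it drops out of the
commutator. -/
theorem IsQuasiSMatrix.dualProd_sub_dualProd (hr : L.IsQuasiSMatrix r) (α β : CoSec E F V) :
    L.dualProd r α β - L.dualProd r β α =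
      L.dual (r.sharpSec α) β - L.dual (r.sharpSec β) α := by
  refine coSec_ext fun X x => ?_
  have h := hr.apply_sharpDeriv_comm X α β x
  simp only [ContMDiffSection.coe_sub, Pi.sub_apply, sub_apply, dualProd_apply']
  linarith

theorem IsQuasiSMatrix.delta_eq (hr : L.IsQuasiSMatrix r) (α β : CoSec E F V) :
    L.delta r α β = L.sharpDeriv r (r.sharpSec β) α - L.sharpDeriv r (r.sharpSec α) β := by
  simp only [delta, hr.dualProd_sub_dualProd, sharpDeriv, bracket, r.sharpSec_sub]
  abel

/-- By `delta_eq` there are six terms $\langle\gamma,(\nabla_{r_\#\beta}r_\#)\alpha\rangle$ with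
signs; the symmetry in $\alpha,\gamma$ cancels them in pairs. -/
theorem IsQuasiSMatrix.delta_cyclic (hr : L.IsQuasiSMatrix r) (α β γ : CoSec E F V) (x : M) :
    γ x (L.delta r α β x) + α x (L.delta r β γ x) + β x (L.delta r γ α x) = 0 := by
  have h1 := hr.apply_sharpDeriv_comm (r.sharpSec α) β γ x
  have h2 := hr.apply_sharpDeriv_comm (r.sharpSec β) α γ x
  have h3 := hr.apply_sharpDeriv_comm (r.sharpSec γ) α β x
  simp only [hr.delta_eq, ContMDiffSection.coe_sub, Pi.sub_apply, map_sub]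
  linarith

variable (L r) in
theorem delta_sub_left (α β γ : CoSec E F V) :
    L.delta r (α - β) γ = L.delta r α γ - L.delta r β γ := by
  have h1 : L.dualProd r (α - β) γ = L.dualProd r α γ - L.dualProd r β γ :=
    map_sub (AddMonoidHom.mk' (fun α => L.dualProd r α γ)
      fun α β => L.dualProd_map_add_left r α β γ) α β
  have h2 : L.dualProd r γ (α - β) = L.dualProd r γ α - L.dualProd r γ β :=
    map_sub (AddMonoidHom.mk' (L.dualProd r γ) (L.dualProd_map_add_right r γ)) α β
  simp only [delta, h1, h2, r.sharpSec_sub, bracket_sub_left]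
  abel

variable (L r) in
theorem delta_swap (α β : CoSec E F V) : L.delta r α β = -L.delta r β α := by
  simp only [delta, r.sharpSec_sub, L.bracket_swap (r.sharpSec α)]
  abel

/-- Because $\rho\circ\Delta(r)=0$, the left side is $-\langle\gamma,S_\Delta
X\rangle=\langle\gamma,[X,\Delta]_S\rangle-\langle\gamma,S_X\Delta\rangle$ with
$\Delta=\Delta(r)(\alpha,\beta)$. Invariance rewrites the first term and the definition of
$S^*_X\gamma$ the second. -/
theorem IsQuasiSMatrix.dual_delta_apply (hr : L.IsQuasiSMatrix r) (α β γ : CoSec E F V)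
    (X : Sec E F V) (x : M) : L.dual (L.delta r α β) γ x (X x) =
      γ x (L.delta r (L.dual X α) β x) + γ x (L.delta r α (L.dual X β) x)
        + L.dual X γ x (L.delta r α β x)
        - anchorDeriv L.anchor X (fun y => γ y (L.delta r α β y)) x := by
  have h := congrArg (γ x) (DFunLike.congr_fun (hr.delta_invariant X α β) x)
  simp only [bracket, ContMDiffSection.coe_sub, Pi.sub_apply, map_sub, ContMDiffSection.coe_zero,
    Pi.zero_apply, map_zero] at h
  rw [dual_apply, dual_apply, anchorDeriv_eq_zero _ _ _ _ (hr.anchor_delta α β x)]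
  linarith

theorem IsQuasiSMatrix.dual_delta_cyclic (hr : L.IsQuasiSMatrix r) (α β γ : CoSec E F V) :
    L.dual (L.delta r α β) γ + L.dual (L.delta r β γ) α + L.dual (L.delta r γ α) β = 0 := by
  refine coSec_ext fun X x => ?_
  have h1 := hr.delta_cyclic (L.dual X α) β γ x
  have h2 := hr.delta_cyclic α (L.dual X β) γ x
  have h3 := hr.delta_cyclic α β (L.dual X γ) x
  have h4 := anchorDeriv_add L.anchor X _ _
    ((contMDiff_pair γ (L.delta r α β)).add (contMDiff_pair α (L.delta r β γ)))
    (contMDiff_pair β (L.delta r γ α)) x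
  have h5 := anchorDeriv_add L.anchor X _ _ (contMDiff_pair γ (L.delta r α β))
    (contMDiff_pair α (L.delta r β γ)) x
  simp only [Pi.add_def] at h4
  -- The derivative terms add up to the derivative of the zero function; the other nine are `h1`,
  -- `h2` and `h3`.
  simp only [hr.delta_cyclic, anchorDeriv_const] at h4
  simp only [ContMDiffSection.coe_add, Pi.add_apply, add_apply, hr.dual_delta_apply,
    ContMDiffSection.coe_zero, Pi.zero_apply, zero_apply]
  linarith

/-- Invariance with each differentiated covector moved to the first slot, to match the terms that
`delta_sub_left` produces in the Jacobi sum. -/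
theorem IsQuasiSMatrix.bracket_delta (hr : L.IsQuasiSMatrix r) (α β : CoSec E F V)
    (X : Sec E F V) : L.bracket (L.delta r α β) X =
      L.delta r (L.dual X β) α - L.delta r (L.dual X α) β := by
  rw [L.bracket_swap, sub_eq_zero.1 ((sub_sub _ _ _).symm.trans (hr.delta_invariant X α β)),
    L.delta_swap r α]
  abel

/-- The Jacobi identity of `[ , ]^{▷,r}` for a quasi `𝕊`-matrix `r`. -/
theorem IsQuasiSMatrix.bracketTriR_jacobi (hr : L.IsQuasiSMatrix r) (a b c : PhaseSec E F V) :
    L.bracketTriR r (L.bracketTriR r a b) c + L.bracketTriR r (L.bracketTriR r b c) a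
      + L.bracketTriR r (L.bracketTriR r c a) b = 0 := by
  refine phaseSec_ext ?_ ?_
  -- Component in $A$: the terms $[\Delta(r)(\alpha,\beta),Z]_S$ cancel against those where
  -- $\Delta(r)$ is fed $S^*_X\beta-S^*_Y\alpha$, leaving the Jacobi sum of $[\,,]_S$.
  · have hj := L.bracket_jacobi (phaseFst a) (phaseFst b) (phaseFst c)
    simp only [bracketTriR, bracketTri, phaseFst_add, phaseSnd_add, phaseFst_mk, phaseSnd_mk,
      phaseFst_zero, add_zero, bracket_add_left, delta_sub_left, hr.bracket_delta]
    rw [← hj]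
    abel
  -- Component in $A^*$: the representation property of $S^*$ leaves only the cyclic sum of
  -- $S^*_{\Delta(r)(\alpha,\beta)}\gamma$.
  · have hd := hr.dual_delta_cyclic (phaseSnd a) (phaseSnd b) (phaseSnd c)
    simp only [bracketTriR, bracketTri, phaseFst_add, phaseSnd_add, phaseFst_mk, phaseSnd_mk,
      phaseSnd_zero, add_zero, dual_map_add_left, dual_sub_right, dual_bracket]
    rw [← hd]
    abel

end LeftSymmetricAlgebroid

end Algebra

end ParaKahler

namespace ParaKahler

/-! ### The exact para-Kähler structure and the isomorphism $\xi$. -/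

section ExactStructure

variable {E : Type*} [NormedAddCommGroup E] [NormedSpace ℝ E] [FiniteDimensional ℝ E]
  {M : Type*} [TopologicalSpace M] [ChartedSpace E M] [IsManifold 𝓘(ℝ, E) ∞ M] [T2Space M]
  {F : Type*} [NormedAddCommGroup F] [NormedSpace ℝ F] [FiniteDimensional ℝ F]
  {V : M → Type*} [TopologicalSpace (TotalSpace F V)]
  [∀ x, AddCommGroup (V x)] [∀ x, Module ℝ (V x)] [∀ x, TopologicalSpace (V x)]
  [FiberBundle F V] [VectorBundle ℝ F V] [ContMDiffVectorBundle ∞ F V 𝓘(ℝ, E)]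

theorem TensorSec.xi_xiInv (r : TensorSec E F V) (x : M) (v : V x × (V x →L[ℝ] ℝ)) :
    r.xi x (r.xiInv x v) = v := by
  refine Prod.ext ?_ rfl
  exact add_sub_cancel_right _ _

theorem TensorSec.xiInv_xi (r : TensorSec E F V) (x : M) (v : V x × (V x →L[ℝ] ℝ)) :
    r.xiInv x (r.xi x v) = v := by
  refine Prod.ext ?_ rfl
  exact sub_add_cancel _ _

/-- The shift by $-r_\#$ contributes $-r(\alpha,\beta)-r(\beta,\alpha)$, in which the skew part of
$r$ disappears. -/
theorem TensorSec.phaseMetric_xi (r : TensorSec E F V) (x : M) (u v : V x × (V x →L[ℝ] ℝ)) :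
    ParaKahler.phaseMetric (r.xi x u) (r.xi x v) = r.phaseMetric x u v := by
  simp only [ParaKahler.phaseMetric, TensorSec.phaseMetric, LinearMap.mk₂_apply, xi,
    LinearMap.coe_mk, AddHom.coe_mk, map_sub, apply_sharp, evalTensor_symmPart]
  ring

theorem TensorSec.phaseK_xi (r : TensorSec E F V) (x : M) (u : V x × (V x →L[ℝ] ℝ)) :
    ParaKahler.phaseK (r.xi x u) = r.xi x (r.phaseK x u) := by
  refine Prod.ext ?_ rfl
  simp only [ParaKahler.phaseK, TensorSec.phaseK, xi, LinearMap.coe_mk, AddHom.coe_mk, map_neg]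
  module

namespace LeftSymmetricAlgebroid

variable (L : LeftSymmetricAlgebroid E F V) (r : TensorSec E F V)

/-- The Levi-Civita connection of the exact para-Kähler Lie algebroid of `r`:
`D_{X + α}(Y + β) = S_X Y + T*_α Y + S*_X β + T_α β`. -/
def exactConnection (a b : PhaseSec E F V) : PhaseSec E F V :=
  phaseMk (L.prod (phaseFst a) (phaseFst b) + L.dualProdDual r (phaseSnd a) (phaseFst b))
    (L.dual (phaseFst a) (phaseSnd b) + L.dualProd r (phaseSnd a) (phaseSnd b))

theorem dualProdDual_add_left (α β : CoSec E F V) (Y : Sec E F V) :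
    L.dualProdDual r (α + β) Y = L.dualProdDual r α Y + L.dualProdDual r β Y := by
  simp only [dualProdDual_eq, r.sharpSec_add, bracket_add_left, dual_map_add_right]
  abel

theorem dualProdDual_add_right (α : CoSec E F V) (X Y : Sec E F V) :
    L.dualProdDual r α (X + Y) = L.dualProdDual r α X + L.dualProdDual r α Y := by
  simp only [dualProdDual_eq, r.sharpSec_add, bracket_add_right, dual_map_add_left]
  abel

/-- In `dualProdDual_eq` the bracket contributes $-\rho(Y)(f)\,r_\#\alpha$ and the term
$r_\#(S^*_Y(f\alpha))$ the opposite. -/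
theorem dualProdDual_fsmul_left (f : C^∞⟮𝓘(ℝ, E), M; ℝ⟯) (α : CoSec E F V) (Y : Sec E F V) :
    L.dualProdDual r (fsmul f α) Y = fsmul f (L.dualProdDual r α Y) := by
  ext x
  simp only [dualProdDual_eq, r.sharpSec_fsmul, bracket, ContMDiffSection.coe_sub,
    ContMDiffSection.coe_add, Pi.add_apply, Pi.sub_apply, L.rightAnchored.fsmul_left,
    L.rightAnchored.anchored, fsmul_apply, TensorSec.sharpSec_apply, dual_fsmul_right, map_add,
    map_smul]
  module

theorem dualProdDual_fsmul_right (f : C^∞⟮𝓘(ℝ, E), M; ℝ⟯) (α : CoSec E F V) (Y : Sec E F V)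
    (x : M) : L.dualProdDual r α (fsmul f Y) x =
      f x • L.dualProdDual r α Y x + anchorDeriv L.anchor (r.sharpSec α) f x • Y x := by
  simp only [dualProdDual_eq, bracket, ContMDiffSection.coe_sub,
    ContMDiffSection.coe_add, Pi.add_apply, Pi.sub_apply, L.rightAnchored.fsmul_left,
    L.rightAnchored.anchored, fsmul_apply, TensorSec.sharpSec_apply, dual_fsmul_left, map_smul]
  module

theorem anchorDeriv_anchorExact (a : PhaseSec E F V) (f : M → ℝ) (x : M) :
    anchorDeriv (L.anchorExact r) a f x = anchorDeriv L.anchor (phaseFst a) f x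
      + anchorDeriv L.anchor (r.sharpSec (phaseSnd a)) f x := by
  have : L.anchorExact r x (a x) =
      L.anchor x (phaseFst a x) + L.anchor x (r.sharpSec (phaseSnd a) x) := rfl
  simp only [anchorDeriv, this, map_add]

theorem exactConnection_anchored (a : PhaseSec E F V) (f : C^∞⟮𝓘(ℝ, E), M; ℝ⟯)
    (b : PhaseSec E F V) (x : M) : L.exactConnection r a (fsmul f b) x =
      f x • L.exactConnection r a b x + anchorDeriv (L.anchorExact r) a f x • b x := by
  rw [anchorDeriv_anchorExact]
  refine Prod.ext ?_ ?_
  · change (L.prod (phaseFst a) (fsmul f (phaseFst b)) x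
        + L.dualProdDual r (phaseSnd a) (fsmul f (phaseFst b)) x) =
      f x • (L.prod (phaseFst a) (phaseFst b) x + L.dualProdDual r (phaseSnd a) (phaseFst b) x)
        + (anchorDeriv L.anchor (phaseFst a) f x
          + anchorDeriv L.anchor (r.sharpSec (phaseSnd a)) f x) • phaseFst b x
    rw [L.rightAnchored.anchored, dualProdDual_fsmul_right]
    module
  · change (L.dual (phaseFst a) (fsmul f (phaseSnd b)) x
        + L.dualProd r (phaseSnd a) (fsmul f (phaseSnd b)) x) =
      f x • (L.dual (phaseFst a) (phaseSnd b) x + L.dualProd r (phaseSnd a) (phaseSnd b) x)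
        + (anchorDeriv L.anchor (phaseFst a) f x
          + anchorDeriv L.anchor (r.sharpSec (phaseSnd a)) f x) • phaseSnd b x
    rw [dual_fsmul_right, dualProd_fsmul_right]
    module

theorem isRightAnchored_exactConnection :
    IsRightAnchored (L.anchorExact r) (L.exactConnection r) := by
  refine ⟨fun a b c => phaseSec_ext ?_ ?_, fun a b c => phaseSec_ext ?_ ?_, fun t a b => ?_,
    fun f a b => phaseSec_ext ?_ ?_, L.exactConnection_anchored r⟩
  · simp only [exactConnection, phaseFst_add, phaseSnd_add, phaseFst_mk,
      L.rightAnchored.add_left, dualProdDual_add_left]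
    abel
  · simp only [exactConnection, phaseFst_add, phaseSnd_add, phaseSnd_mk,
      dual_map_add_left, dualProd_map_add_left]
    abel
  · simp only [exactConnection, phaseFst_add, phaseFst_mk,
      L.rightAnchored.add_right, dualProdDual_add_right]
    abel
  · simp only [exactConnection, phaseSnd_add, phaseSnd_mk,
      dual_map_add_right, dualProd_map_add_right]
    abel
  · ext x : 1
    refine (L.exactConnection_anchored r a ⟨fun _ => t, contMDiff_const⟩ b x).trans ?_
    refine Eq.trans (congrArg _ ?_) (add_zero _)
    exact (congrArg (· • b x) (anchorDeriv_const (L.anchorExact r) a t x)).trans (zero_smul _ _)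
  · simp only [exactConnection, phaseFst_fsmul, phaseSnd_fsmul, phaseFst_mk,
      L.rightAnchored.fsmul_left, dualProdDual_fsmul_left]
    ext x
    exact (smul_add _ _ _).symm
  · simp only [exactConnection, phaseFst_fsmul, phaseSnd_fsmul, phaseSnd_mk,
      dualProd_fsmul_left]
    ext1 x
    change L.dual _ _ x + _ = _
    rw [dual_fsmul_left]
    exact (smul_add _ _ _).symm

/-- Valid for every $r$. The pairs $S,S^*$ and $T,T^*$ are dual by definition, so the pairing is
parallel, and the commutator of the connection is the bracket term by term. -/
theorem isLeviCivita_exactConnection :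
    IsLeviCivita (L.anchorExact r) (L.bracketExact r) (fun _ => phaseMetric)
      (L.exactConnection r) := by
  refine ⟨L.isRightAnchored_exactConnection r, fun a b c x => ?_, fun a b => phaseSec_ext ?_ ?_⟩
  · change anchorDeriv (L.anchorExact r) a
        (fun y => phaseSnd b y (phaseFst c y) + phaseSnd c y (phaseFst b y)) x =
      ((L.dual (phaseFst a) (phaseSnd b) x + L.dualProd r (phaseSnd a) (phaseSnd b) x)
          (phaseFst c x)
        + phaseSnd c x
          (L.prod (phaseFst a) (phaseFst b) x + L.dualProdDual r (phaseSnd a) (phaseFst b) x))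
      + (phaseSnd b x
          (L.prod (phaseFst a) (phaseFst c) x + L.dualProdDual r (phaseSnd a) (phaseFst c) x)
        + (L.dual (phaseFst a) (phaseSnd c) x + L.dualProd r (phaseSnd a) (phaseSnd c) x)
          (phaseFst b x))
    rw [anchorDeriv_anchorExact,
      anchorDeriv_add _ _ _ _ (contMDiff_pair _ _) (contMDiff_pair _ _),
      anchorDeriv_add _ _ _ _ (contMDiff_pair _ _) (contMDiff_pair _ _)]
    simp only [add_apply, map_add, dual_apply, apply_dualProdDual]
    ring
  · simp only [exactConnection, bracketExact, bracket, phaseFst_sub, phaseFst_mk]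
    abel
  · simp only [exactConnection, bracketExact, phaseSnd_sub, phaseSnd_mk]
    abel

theorem anchorExact_xi (x : M) (v : V x × (V x →L[ℝ] ℝ)) :
    L.anchorExact r x (r.xi x v) = L.anchorZero x v := by
  change L.anchor x (v.1 - r.sharp x v.2) + L.anchor x (r.sharp x v.2) = L.anchor x v.1
  rw [map_sub, sub_add_cancel]

variable {L r}

/-- Of the conditions on $r$ only $S\mathfrak a=0$ enters, through `dualProd_sub_dualProd`. In $A^*$
the commutator $[\alpha,\beta]_T$ undoes the shift of $X,Y$ by $-r_\#\alpha,-r_\#\beta$; in $A$ the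
leftover of the shift is $\Delta(r)(\alpha,\beta)$. -/
theorem IsQuasiSMatrix.isLieAlgebroidIso_xi (hr : L.IsQuasiSMatrix r) :
    IsLieAlgebroidIso L.anchorZero (L.bracketTriR r) (L.anchorExact r) (L.bracketExact r) r.xi := by
  refine ⟨r.isBundleHom_xi, ⟨r.xiInv, r.isBundleHom_xiInv, r.xiInv_xi, r.xi_xiInv⟩,
    L.anchorExact_xi r, fun a b => phaseSec_ext ?_ ?_⟩
  · have hfst : ∀ c, phaseFst (mapSec r.xi r.isBundleHom_xi c) =
        phaseFst c - r.sharpSec (phaseSnd c) := fun _ => rfl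
    have hsnd : ∀ c, phaseSnd (mapSec r.xi r.isBundleHom_xi c) = phaseSnd c := fun _ => rfl
    simp only [hfst, hsnd, bracketTriR, bracketTri, bracketExact, phaseFst_add, phaseSnd_add,
      phaseFst_mk, phaseSnd_mk, add_zero, dual_sub_left, bracket_sub_left,
      bracket_sub_right, dualProdDual_eq, delta, hr.dualProd_sub_dualProd, r.sharpSec_sub]
    simp only [bracket]
    abel
  · have hfst : ∀ c, phaseFst (mapSec r.xi r.isBundleHom_xi c) =
        phaseFst c - r.sharpSec (phaseSnd c) := fun _ => rfl
    have hsnd : ∀ c, phaseSnd (mapSec r.xi r.isBundleHom_xi c) = phaseSnd c := fun _ => rfl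
    simp only [hfst, hsnd, bracketTriR, bracketTri, bracketExact, phaseSnd_add,
      phaseSnd_mk, add_zero, dual_sub_left, hr.dualProd_sub_dualProd]
    abel

theorem IsQuasiSMatrix.isParaKahler_exact (hr : L.IsQuasiSMatrix r) :
    IsParaKahler (L.anchorExact r) (L.bracketExact r) (fun _ => phaseMetric)
      (fun _ => phaseK) := by
  refine ⟨(L.isRightAnchored_exactConnection r).isLieAlgebroid (L.isBundleHom_anchorExact r)
    (L.isLeviCivita_exactConnection r).torsion_free
    (hr.isLieAlgebroidIso_xi.jacobi hr.bracketTriR_jacobi),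
    isPseudoRiemannianMetric_phaseMetric, isBundleHom_phaseK, fun x v => ?_, fun x u v => ?_,
    L.exactConnection r, L.isLeviCivita_exactConnection r, fun a b => ?_⟩
  · simp [phaseK]
  · simp [phaseK, phaseMetric, add_comm]
  -- In its second argument the connection acts separately on the two summands, the $\pm1$
  -- eigenbundles of $K_0$, so it commutes with $K_0$.
  · have hfst : ∀ c : PhaseSec E F V, phaseFst (mapSec _ isBundleHom_phaseK c) = phaseFst c :=
      fun _ => rfl
    have hsnd : ∀ c : PhaseSec E F V, phaseSnd (mapSec _ isBundleHom_phaseK c) = -phaseSnd c :=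
      fun _ => rfl
    refine phaseSec_ext ?_ ?_
    · simp only [hfst, exactConnection, phaseFst_mk]
    · have h1 : L.dual (phaseFst a) (-phaseSnd b) = -L.dual (phaseFst a) (phaseSnd b) :=
        map_neg (AddMonoidHom.mk' (L.dual (phaseFst a)) (L.dual_map_add_right _)) _
      have h2 : L.dualProd r (phaseSnd a) (-phaseSnd b) =
          -L.dualProd r (phaseSnd a) (phaseSnd b) :=
        map_neg (AddMonoidHom.mk' (L.dualProd r (phaseSnd a)) (L.dualProd_map_add_right r _)) _
      simp only [hfst, hsnd, exactConnection, phaseSnd_mk, h1, h2]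
      abel

end LeftSymmetricAlgebroid

end ExactStructure

end ParaKahler

end

theorem proposition5p2
    {E : Type*} [NormedAddCommGroup E] [NormedSpace ℝ E] [FiniteDimensional ℝ E]
    {M : Type*} [TopologicalSpace M] [ChartedSpace E M] [IsManifold 𝓘(ℝ, E) ∞ M] [T2Space M]
    {F : Type*} [NormedAddCommGroup F] [NormedSpace ℝ F] [FiniteDimensional ℝ F]
    {V : M → Type*} [TopologicalSpace (TotalSpace F V)]
    [∀ x, AddCommGroup (V x)] [∀ x, Module ℝ (V x)] [∀ x, TopologicalSpace (V x)]
    [FiberBundle F V] [VectorBundle ℝ F V] [ContMDiffVectorBundle ∞ F V 𝓘(ℝ, E)]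
    (L : ParaKahler.LeftSymmetricAlgebroid E F V) (r : ParaKahler.TensorSec E F V)
    (hr : L.IsQuasiSMatrix r) :
    -- `(V ⊕ V*, [ , ]^{▷,r}, ρ + 0)` is a Lie algebroid
    ParaKahler.IsLieAlgebroid L.anchorZero (L.bracketTriR r) ∧
    -- `(V ⊕ V*, [ , ]^r, ρ + ρ_r, ⟨ , ⟩₀, K₀)` is a para-Kähler Lie algebroid
    ParaKahler.IsParaKahler (L.anchorExact r) (L.bracketExact r)
      (fun _ => ParaKahler.phaseMetric) (fun _ => ParaKahler.phaseK) ∧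
    -- `ξ` is an isomorphism of Lie algebroids from the first one to the second one
    ParaKahler.IsLieAlgebroidIso L.anchorZero (L.bracketTriR r)
      (L.anchorExact r) (L.bracketExact r) r.xi ∧
    -- `ξ` transports `⟨ , ⟩_r` to `⟨ , ⟩₀` and `K_r` to `K₀`
    (∀ x u v, ParaKahler.phaseMetric (r.xi x u) (r.xi x v) = r.phaseMetric x u v) ∧
    (∀ x u, ParaKahler.phaseK (r.xi x u) = r.xi x (r.phaseK x u)) ∧
    -- `(V ⊕ V*, [ , ]^{▷,r}, ρ + 0, ⟨ , ⟩_r, K_r)` is a para-Kähler Lie algebroid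
    ParaKahler.IsParaKahler L.anchorZero (L.bracketTriR r) r.phaseMetric r.phaseK := by
  have hK := hr.isParaKahler_exact
  have hxi := hr.isLieAlgebroidIso_xi
  exact ⟨hxi.isLieAlgebroid hK.lieAlgebroid, hK, hxi, r.phaseMetric_xi, r.phaseK_xi,
    hxi.isParaKahler r.phaseMetric_xi r.phaseK_xi hK⟩
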